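/- All rings are commutative with $1$. Let $A$ be a noetherian ring with an ideal $\mathfrak o(A)\neq A$ such that $A$ is $\mathfrak o(A)$-adically complete and separated, i.e. $\bigcap_e\mathfrak o(A)^e=\{0\}$. For $Y=(Y_1,\dots,Y_n)$, $n\ge 0$, let $A\langle Y\rangle\subseteq A[[Y]]$ be the ring of series $\sum_\nu a_\nu Y^\nu$ with $a_\nu\to 0$ in the $\mathfrak o(A)$-adic topology as $|\nu|\to\infty$. An *$A$-analytic structure* on a ring $R$ is a family of ring morphisms $\iota_n$ from $A\langle Y_1,\dots,Y_n\rangle$ to the ring of functions $R^n\to R$ ($n=0,1,2,\dots$; we write $f(y)$ for $\iota_n(f)(y)$) such that $\iota_n(Y_k)(y)=y_k$; $\iota_n(f)(y_1,\dots,y_n)=\iota_{n+1}(f)(y_1,\dots,y_{n+1})$ for $f\in A\langle Y_1,\dots,Y_n\rangle$; and $\iota_n(f)(y_{n+1},\dots,y_{2n})=\iota_{2n}\big(f(Y_{n+1},\dots,Y_{2n})\big)(y_1,\dots,y_{2n})$ for $f\in A\langle Y_1,\dots,Y_n\rangle$. In particular $\iota_0$ is a ring morphism $A\to R$. A *valuation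 $A$-ring* is a valuation ring $R$ equipped with an $A$-analytic structure; it is *viable* if the ideal $\mathfrak o(A)R$ generated by $\iota_0(\mathfrak o(A))$ equals the maximal ideal of $R$ and is nonzero. Let $R$ be a viable valuation $A$-ring with fraction field $K$. For $f=\sum_\nu f_\nu(X)Y^\nu\in A\langle X,Y\rangle$ with $X=(X_1,\dots,X_m)$ and $x\in R^m$ put $f(x,Y)=\sum_\nu f_\nu(x)Y^\nu\in R[[Y]]$. Let $R\langle Y\rangle\subseteq R[[Y]]$ be the ring of all such series $f(x,Y)$, with $m$ ranging over $\mathbb N$, and let $K\langle Y\rangle=\{c^{-1}g:\ c\in R\setminus\{0\},\ g\in R\langle Y\rangle\}\subseteq K[[Y]]$. **Theorem.** $K\langle Y\rangle$ is an integral domain and (i) $K\langle Y\rangle$ is noetherian. Moreover, for every proper ideal $I$ of $K\langle Y\rangle$: (ii) there are $m\le n$ and an injective $K$-algebra morphism $K\langle Y_1,\dots,Y_m\rangle\to K\langle Y\rangle/I$ making $K\langle Y\rangle/I$ a finitely generated $K\langle Y_1,\dots,Y_m\rangle$-module; (iii) for every algebraically closed valued field extension $K^{\rm a}$ of $K$ whose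 valuation ring $R^{\rm a}$ is equipped with an $A$-analytic structure extending that of $R$, there is $y\in(R^{\rm a})^n$ such that $f(y)=0$ for all $f\in I$. Here $f$ is viewed in $K^{\rm a}\langle Y\rangle$, and the value at $y$ of $g=c^{-1}h(x,Y)\in K^{\rm a}\langle Y\rangle$ (with $c\in R^{\rm a}\setminus\{0\}$, $h\in A\langle X,Y\rangle$, $x\in(R^{\rm a})^m$) is $g(y)=c^{-1}h(x,y)\in K^{\rm a}$. -/

import Mathlib

namespace AnalyticRing

open MvPowerSeries

section RestrictedSeries

variable {A : Type*} [CommRing A]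

/-- The ring `A⟨Y₁, …, Yₙ⟩` of restricted power series: the coefficients tend to `0` in the
`𝔬`-adic topology of `A`, that is, for every `e` only finitely many of them lie outside `𝔬 ^ e`. -/
def restricted (𝔬 : Ideal A) (n : ℕ) : Subring (MvPowerSeries (Fin n) A) where
  carrier := {f | ∀ e : ℕ, {ν : Fin n →₀ ℕ | coeff ν f ∉ 𝔬 ^ e}.Finite}
  zero_mem' e := by simp
  one_mem' e := by
    classical
    refine (Set.finite_singleton (0 : Fin n →₀ ℕ)).subset fun ν hν => ?_
    by_contra h
    refine hν ?_
    rw [coeff_one, if_neg (by simpa using h)]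
    exact zero_mem _
  add_mem' {f g} hf hg e := by
    refine ((hf e).union (hg e)).subset fun ν hν => ?_
    by_contra h
    simp only [Set.mem_union, Set.mem_ofPred_eq, not_or, not_not] at h
    exact hν (by rw [map_add]; exact add_mem h.1 h.2)
  neg_mem' {f} hf e := by
    refine (hf e).subset fun ν hν h => hν ?_
    rw [map_neg]
    exact neg_mem h
  mul_mem' {f g} hf hg e := by
    classical
    refine ((hf e).add (hg e)).subset fun ν hν => ?_
    by_contra h
    refine hν ?_
    rw [coeff_mul]
    refine Ideal.sum_mem _ fun p hp => ?_
    by_cases h1 : coeff p.1 f ∈ 𝔬 ^ e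
    · exact Ideal.mul_mem_right _ _ h1
    · by_cases h2 : coeff p.2 g ∈ 𝔬 ^ e
      · exact Ideal.mul_mem_left _ _ h2
      · exact absurd ⟨p.1, h1, p.2, h2, Finset.HasAntidiagonal.mem_antidiagonal.1 hp⟩ h

lemma C_mem_restricted (𝔬 : Ideal A) (n : ℕ) (a : A) :
    (C a : MvPowerSeries (Fin n) A) ∈ restricted 𝔬 n := by
  classical
  intro e
  refine (Set.finite_singleton (0 : Fin n →₀ ℕ)).subset fun ν hν => ?_
  by_contra h
  refine hν ?_
  rw [coeff_C, if_neg (by simpa using h)]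
  exact zero_mem _

lemma X_mem_restricted (𝔬 : Ideal A) (n : ℕ) (k : Fin n) :
    (X k : MvPowerSeries (Fin n) A) ∈ restricted 𝔬 n := by
  classical
  intro e
  refine (Set.finite_singleton (Finsupp.single k 1)).subset fun ν hν => ?_
  by_contra h
  refine hν ?_
  rw [coeff_X, if_neg (by simpa using h)]
  exact zero_mem _

/-- The constants in `A⟨Y₁, …, Yₙ⟩`. -/
noncomputable def constants (𝔬 : Ideal A) (n : ℕ) : A →+* restricted 𝔬 n :=
  (C : A →+* MvPowerSeries (Fin n) A).codRestrict _ (C_mem_restricted 𝔬 n)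

/-- The indeterminate `Y_k` in `A⟨Y₁, …, Yₙ⟩`. -/
noncomputable def indet (𝔬 : Ideal A) {n : ℕ} (k : Fin n) : restricted 𝔬 n :=
  ⟨X k, X_mem_restricted 𝔬 n k⟩

lemma rename_mem_restricted {𝔬 : Ideal A} {m n : ℕ} (e : Fin m ↪ Fin n)
    {f : MvPowerSeries (Fin m) A} (hf : f ∈ restricted 𝔬 m) : rename e f ∈ restricted 𝔬 n := by
  intro k
  refine ((hf k).image (Finsupp.embDomain e)).subset fun ν hν => ?_
  by_cases h : ν ∈ Set.range (Finsupp.mapDomain e)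
  · obtain ⟨μ, rfl⟩ := h
    refine ⟨μ, fun hμ => hν ?_, Finsupp.embDomain_eq_mapDomain e μ⟩
    rw [← Finsupp.embDomain_eq_mapDomain, coeff_embDomain_rename]
    exact hμ
  · refine absurd ?_ hν
    rw [coeff_rename_eq_zero _ _ h]
    exact zero_mem _

/-- Renaming the indeterminates, `f(Y₁, …, Yₘ) ↦ f(Y_{e 1}, …, Y_{e m})`. -/
noncomputable def renameVars (𝔬 : Ideal A) {m n : ℕ} (e : Fin m ↪ Fin n) :
    restricted 𝔬 m →+* restricted 𝔬 n :=
  ((rename (R := A) e : _ →ₐ[A] _).toRingHom.comp (restricted 𝔬 m).subtype).codRestrict _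
    fun f => rename_mem_restricted e f.2

/-- The exponent of the monomial `X ^ μ * Y ^ ν`, where `X = (X₁, …, Xₘ)` are the first `m` and
`Y = (Y₁, …, Yₙ)` the last `n` of the `m + n` indeterminates. -/
noncomputable def joinExp {m n : ℕ} (μ : Fin m →₀ ℕ) (ν : Fin n →₀ ℕ) : Fin (m + n) →₀ ℕ :=
  Finsupp.equivFunOnFinite.symm (Fin.append μ ν)

lemma joinExp_add {m n : ℕ} (μ μ' : Fin m →₀ ℕ) (ν ν' : Fin n →₀ ℕ) :
    joinExp (μ + μ') (ν + ν') = joinExp μ ν + joinExp μ' ν' := by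
  ext i
  refine Fin.addCases (fun i => ?_) (fun i => ?_) i <;> simp [joinExp]

lemma joinExp_inj {m n : ℕ} {μ μ' : Fin m →₀ ℕ} {ν ν' : Fin n →₀ ℕ} :
    joinExp μ ν = joinExp μ' ν' ↔ μ = μ' ∧ ν = ν' := by
  refine ⟨fun h => ⟨?_, ?_⟩, fun h => by rw [h.1, h.2]⟩
  · ext i
    simpa [joinExp] using DFunLike.congr_fun h (Fin.castAdd n i)
  · ext i
    simpa [joinExp] using DFunLike.congr_fun h (Fin.natAdd m i)

lemma exists_joinExp {m n : ℕ} (a : Fin (m + n) →₀ ℕ) :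
    ∃ (μ : Fin m →₀ ℕ) (ν : Fin n →₀ ℕ), joinExp μ ν = a := by
  refine ⟨Finsupp.equivFunOnFinite.symm fun i => a (Fin.castAdd n i),
    Finsupp.equivFunOnFinite.symm fun i => a (Fin.natAdd m i), ?_⟩
  ext i
  refine Fin.addCases (fun i => ?_) (fun i => ?_) i <;> simp [joinExp]

/-- For `f = ∑_ν f_ν(X) Y ^ ν` in `A⟨X, Y⟩`, the coefficient `f_ν` as a power series. -/
noncomputable def sliceSeries {m n : ℕ} (f : MvPowerSeries (Fin (m + n)) A) (ν : Fin n →₀ ℕ) :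
    MvPowerSeries (Fin m) A :=
  fun μ => coeff (joinExp μ ν) f

lemma coeff_sliceSeries {m n : ℕ} (f : MvPowerSeries (Fin (m + n)) A) (ν : Fin n →₀ ℕ)
    (μ : Fin m →₀ ℕ) : coeff μ (sliceSeries f ν) = coeff (joinExp μ ν) f := rfl

/-- For `f = ∑_ν f_ν(X) Y ^ ν` in `A⟨X, Y⟩`, the coefficient `f_ν ∈ A⟨X⟩`. -/
noncomputable def slice {𝔬 : Ideal A} {m n : ℕ} (f : restricted 𝔬 (m + n)) (ν : Fin n →₀ ℕ) :
    restricted 𝔬 m :=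
  ⟨sliceSeries f ν, fun e =>
    Set.Finite.preimage (s := {κ | coeff κ f.1 ∉ 𝔬 ^ e}) (f := fun μ => joinExp μ ν)
      (fun _ _ _ _ h => (joinExp_inj.1 h).1) (f.2 e)⟩

lemma slice_add {𝔬 : Ideal A} {m n : ℕ} (f g : restricted 𝔬 (m + n)) (ν : Fin n →₀ ℕ) :
    slice (f + g) ν = slice f ν + slice g ν := rfl

lemma slice_mul {𝔬 : Ideal A} {m n : ℕ} (f g : restricted 𝔬 (m + n)) (ν : Fin n →₀ ℕ) :
    slice (f * g) ν = ∑ p ∈ Finset.HasAntidiagonal.antidiagonal ν, slice f p.1 * slice g p.2 := by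
  classical
  apply Subtype.ext
  ext μ
  rw [AddSubmonoidClass.coe_finsetSum, map_sum]
  simp only [Subring.coe_mul, slice, coeff_sliceSeries, coeff_mul]
  rw [← Finset.sum_product']
  symm
  refine Finset.sum_bij (fun p _ => (joinExp p.2.1 p.1.1, joinExp p.2.2 p.1.2)) ?_ ?_ ?_ ?_
  · rintro ⟨⟨a, b⟩, c, d⟩ h
    simp only [Finset.mem_product, Finset.HasAntidiagonal.mem_antidiagonal] at h ⊢
    rw [← joinExp_add, h.1, h.2]
  · rintro ⟨⟨a, b⟩, c, d⟩ - ⟨⟨a', b'⟩, c', d'⟩ - h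
    simp only [Prod.mk.injEq, joinExp_inj] at h ⊢
    tauto
  · rintro ⟨u, v⟩ h
    obtain ⟨c, a, rfl⟩ := exists_joinExp u
    obtain ⟨d, b, rfl⟩ := exists_joinExp v
    rw [Finset.HasAntidiagonal.mem_antidiagonal, ← joinExp_add, joinExp_inj] at h
    exact ⟨⟨⟨a, b⟩, c, d⟩, by simp [h.1, h.2], rfl⟩
  · intro _ _
    rfl

/-- Embedding of the indices of `(X, Y)` into those of `(X', Y)`. -/
def padEmb {m m' : ℕ} (n : ℕ) (e : Fin m ↪ Fin m') : Fin (m + n) ↪ Fin (m' + n) :=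
  finSumFinEquiv.symm.toEmbedding.trans
    ((e.sumMap (Function.Embedding.refl _)).trans finSumFinEquiv.toEmbedding)

lemma embDomain_padEmb {m m' n : ℕ} (e : Fin m ↪ Fin m') (μ : Fin m →₀ ℕ) (ν : Fin n →₀ ℕ) :
    Finsupp.embDomain (padEmb n e) (joinExp μ ν) = joinExp (Finsupp.embDomain e μ) ν := by
  ext i
  refine Fin.addCases (fun i => ?_) (fun i => ?_) i
  · by_cases h : i ∈ Set.range e
    · obtain ⟨j, rfl⟩ := h
      have : Fin.castAdd n (e j) = padEmb n e (Fin.castAdd n j) := by simp [padEmb]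
      rw [this, Finsupp.embDomain_apply_self, ← this]
      simp [joinExp]
    · rw [Finsupp.embDomain_of_notMem_range]
      · simp [joinExp, Finsupp.embDomain_of_notMem_range _ _ _ h]
      · rintro ⟨k, hk⟩
        revert hk
        refine Fin.addCases (fun k => ?_) (fun k => ?_) k
        · intro hk
          refine h ⟨k, ?_⟩
          simpa [padEmb] using hk
        · intro hk
          have := congrArg Fin.val hk
          simp [padEmb] at this
          omega
  · have : Fin.natAdd m' i = padEmb n e (Fin.natAdd m i) := by simp [padEmb]
    rw [this, Finsupp.embDomain_apply_self, ← this]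
    simp [joinExp]

lemma slice_renameVars {𝔬 : Ideal A} {m m' n : ℕ} (e : Fin m ↪ Fin m')
    (f : restricted 𝔬 (m + n)) (ν : Fin n →₀ ℕ) :
    slice (renameVars 𝔬 (padEmb n e) f) ν = renameVars 𝔬 e (slice f ν) := by
  apply Subtype.ext
  ext μ
  change coeff (joinExp μ ν) (rename (padEmb n e) (f : MvPowerSeries _ A)) =
    coeff μ (rename e (sliceSeries (f : MvPowerSeries _ A) ν))
  by_cases h : μ ∈ Set.range (Finsupp.mapDomain e)
  · obtain ⟨κ, rfl⟩ := h
    rw [← Finsupp.embDomain_eq_mapDomain, ← embDomain_padEmb, coeff_embDomain_rename,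
      coeff_embDomain_rename, coeff_sliceSeries]
  · rw [coeff_rename_eq_zero _ _ h, coeff_rename_eq_zero]
    rintro ⟨κ, hκ⟩
    obtain ⟨a, b, rfl⟩ := exists_joinExp κ
    rw [← Finsupp.embDomain_eq_mapDomain, embDomain_padEmb, joinExp_inj] at hκ
    exact h ⟨a, by rw [← Finsupp.embDomain_eq_mapDomain]; exact hκ.1⟩

end RestrictedSeries

/-- An `A`-analytic structure on a ring `R`: ring morphisms `ι_n` from `A⟨Y₁, …, Yₙ⟩` to the ring
of `R`-valued functions on `Rⁿ`, one for each `n`, such that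
* `ι_n(Y_k)` is the `k`-th coordinate function;
* `ι_n(f)(y₁, …, yₙ) = ι_{n+1}(f)(y₁, …, yₙ₊₁)` for `f ∈ A⟨Y₁, …, Yₙ⟩ ⊆ A⟨Y₁, …, Yₙ₊₁⟩`;
* `ι_n(f)(yₙ₊₁, …, y₂ₙ) = ι_{2n}(f(Yₙ₊₁, …, Y₂ₙ))(y₁, …, y₂ₙ)` for `f ∈ A⟨Y₁, …, Yₙ⟩`. -/
structure AnalyticStructure {A : Type*} [CommRing A] (𝔬 : Ideal A) (R : Type*) [CommRing R] where
  iota : ∀ n : ℕ, restricted 𝔬 n →+* ((Fin n → R) → R)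
  iota_indet : ∀ (n : ℕ) (k : Fin n) (y : Fin n → R), iota n (indet 𝔬 k) y = y k
  iota_castSucc : ∀ (n : ℕ) (f : restricted 𝔬 n) (y : Fin (n + 1) → R),
    iota n f (fun i => y i.castSucc) =
      iota (n + 1) (renameVars 𝔬 (Fin.castSuccEmb (n := n)) f) y
  iota_shift : ∀ (n : ℕ) (f : restricted 𝔬 n) (y : Fin (n + n) → R),
    iota n f (fun i => y (Fin.natAdd n i)) =
      iota (n + n) (renameVars 𝔬 (Fin.natAddEmb n (m := n)) f) y

namespace AnalyticStructure

variable {A : Type*} [CommRing A] {𝔬 : Ideal A} {R : Type*} [CommRing R]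

/-- The structural morphism `ι₀ : A → R`. -/
noncomputable def structMap (S : AnalyticStructure 𝔬 R) : A →+* R :=
  (Pi.evalRingHom (fun _ : Fin 0 → R => R) Fin.elim0).comp ((S.iota 0).comp (constants 𝔬 0))

/-- `R` is viable: the ideal `𝔬 R` is the maximal ideal of `R`, and is nonzero. -/
def IsViable [IsLocalRing R] (S : AnalyticStructure 𝔬 R) : Prop :=
  𝔬.map S.structMap = IsLocalRing.maximalIdeal R ∧ IsLocalRing.maximalIdeal R ≠ ⊥

/-- The analytic structure of the `R`-algebra `R'` extends that of `R`. -/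
def Extends {R' : Type*} [CommRing R'] [Algebra R R'] (S' : AnalyticStructure 𝔬 R')
    (S : AnalyticStructure 𝔬 R) : Prop :=
  ∀ (n : ℕ) (f : restricted 𝔬 n) (y : Fin n → R),
    S'.iota n f (fun i => algebraMap R R' (y i)) = algebraMap R R' (S.iota n f y)

/-- `f(x, Y) = ∑_ν f_ν(x) Y ^ ν` in `R[[Y]]`, for `f = ∑_ν f_ν(X) Y ^ ν` in `A⟨X, Y⟩` and
`x ∈ R ^ m`. -/
noncomputable def specialize (S : AnalyticStructure 𝔬 R) {m n : ℕ} (f : restricted 𝔬 (m + n))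
    (x : Fin m → R) : MvPowerSeries (Fin n) R :=
  fun ν => S.iota m (slice f ν) x

lemma coeff_specialize (S : AnalyticStructure 𝔬 R) {m n : ℕ} (f : restricted 𝔬 (m + n))
    (x : Fin m → R) (ν : Fin n →₀ ℕ) :
    coeff ν (S.specialize f x) = S.iota m (slice f ν) x := rfl

lemma specialize_add (S : AnalyticStructure 𝔬 R) {m n : ℕ} (f g : restricted 𝔬 (m + n))
    (x : Fin m → R) : S.specialize (f + g) x = S.specialize f x + S.specialize g x := by
  ext ν
  simp only [map_add, coeff_specialize, slice_add, Pi.add_apply]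

lemma specialize_mul (S : AnalyticStructure 𝔬 R) {m n : ℕ} (f g : restricted 𝔬 (m + n))
    (x : Fin m → R) : S.specialize (f * g) x = S.specialize f x * S.specialize g x := by
  classical
  ext ν
  simp only [coeff_mul, coeff_specialize, slice_mul, map_sum, map_mul, Finset.sum_apply,
    Pi.mul_apply]

lemma specialize_const (S : AnalyticStructure 𝔬 R) {n : ℕ} (a : R) :
    S.specialize (indet 𝔬 (Fin.castAdd n (0 : Fin 1))) (fun _ => a) = C a := by
  classical
  ext ν
  have key : joinExp (Finsupp.single (0 : Fin 1) 1) (0 : Fin n →₀ ℕ) =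
      Finsupp.single (Fin.castAdd n (0 : Fin 1)) 1 := by
    ext i
    refine Fin.addCases (fun i => ?_) (fun i => ?_) i
    · have : i = 0 := Subsingleton.elim _ _
      subst this
      simp [joinExp]
    · have : Fin.castAdd n (0 : Fin 1) ≠ Fin.natAdd 1 i := by
        intro h
        have := congrArg Fin.val h
        simp at this
        omega
      simp [joinExp, Finsupp.single_eq_of_ne' this]
  rw [coeff_specialize, coeff_C]
  split_ifs with h
  · subst h
    have : slice (indet 𝔬 (Fin.castAdd n (0 : Fin 1))) 0 = indet 𝔬 (0 : Fin 1) := by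
      apply Subtype.ext
      ext μ
      change coeff (joinExp μ 0) (X (Fin.castAdd n (0 : Fin 1)) : MvPowerSeries _ A) =
        coeff μ (X (0 : Fin 1))
      rw [coeff_X, coeff_X, ← key]
      simp only [joinExp_inj, and_true]
    rw [this, S.iota_indet]
  · have : slice (indet 𝔬 (Fin.castAdd n (0 : Fin 1))) ν = 0 := by
      apply Subtype.ext
      ext μ
      change coeff (joinExp μ ν) (X (Fin.castAdd n (0 : Fin 1)) : MvPowerSeries _ A) = 0
      rw [coeff_X, ← key, if_neg]
      rw [joinExp_inj]
      exact fun h' => h h'.2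
    rw [this, map_zero, Pi.zero_apply]

lemma specialize_rename (S : AnalyticStructure 𝔬 R) {m m' n : ℕ} (e : Fin m ↪ Fin m')
    (x : Fin m' → R)
    (he : ∀ h : restricted 𝔬 m, S.iota m' (renameVars 𝔬 e h) x = S.iota m h fun i => x (e i))
    (f : restricted 𝔬 (m + n)) :
    S.specialize (renameVars 𝔬 (padEmb n e) f) x = S.specialize f fun i => x (e i) := by
  ext ν
  rw [coeff_specialize, coeff_specialize, slice_renameVars, he]

lemma exists_pad (S : AnalyticStructure 𝔬 R) {m n : ℕ} (f : restricted 𝔬 (m + n))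
    (x : Fin m → R) (k : ℕ) :
    ∃ (f' : restricted 𝔬 (m + k + n)) (x' : Fin (m + k) → R),
      S.specialize f' x' = S.specialize f x ∧ ∀ i, x' (Fin.castAdd k i) = x i := by
  induction k with
  | zero => exact ⟨f, x, rfl, fun _ => rfl⟩
  | succ k ih =>
    obtain ⟨f', x', h, hx⟩ := ih
    refine ⟨renameVars 𝔬 (padEmb n (Fin.castSuccEmb (n := m + k))) f',
      Fin.snoc (α := fun _ => R) x' 0, ?_, fun i => ?_⟩
    · rw [← h]
      have := S.specialize_rename (Fin.castSuccEmb (n := m + k))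
        (Fin.snoc (α := fun _ => R) x' 0) (fun g => (S.iota_castSucc _ g _).symm) f'
      rw [this]
      congr 1
      ext i
      simp
    · rw [← hx i]
      exact Fin.snoc_castSucc (α := fun _ => R) 0 x' (Fin.castAdd k i)

lemma iota_castAdd (S : AnalyticStructure 𝔬 R) (m k : ℕ) (f : restricted 𝔬 m)
    (x : Fin (m + k) → R) :
    S.iota (m + k) (renameVars 𝔬 (Fin.castAddEmb k (n := m)) f) x =
      S.iota m f fun i => x (Fin.castAdd k i) := by
  induction k with
  | zero =>
    have h : renameVars 𝔬 (Fin.castAddEmb 0 (n := m)) f = f :=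
      Subtype.ext (rename_id_apply (f : MvPowerSeries (Fin m) A))
    exact congrArg (fun g => S.iota m g x) h
  | succ k ih =>
    have h1 := S.iota_castSucc (m + k) (renameVars 𝔬 (Fin.castAddEmb k (n := m)) f) x
    rw [ih] at h1
    have h2 : renameVars 𝔬 (Fin.castAddEmb (k + 1) (n := m)) f =
        renameVars 𝔬 (Fin.castSuccEmb (n := m + k)) (renameVars 𝔬 (Fin.castAddEmb k (n := m)) f) :=
      Subtype.ext (rename_rename (Fin.castAddEmb k (n := m)) (Fin.castSuccEmb (n := m + k))
        (f : MvPowerSeries (Fin m) A)).symm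
    exact (congrArg (fun g => S.iota (m + k + 1) g x) h2).trans h1.symm

/-- Two series `f(x, Y)` and `g(x', Y)` can be written with the same parameters. -/
lemma exists_common (S : AnalyticStructure 𝔬 R) {m m' n : ℕ} (f : restricted 𝔬 (m + n))
    (x : Fin m → R) (g : restricted 𝔬 (m' + n)) (x' : Fin m' → R) :
    ∃ (k : ℕ) (z : Fin k → R) (f' g' : restricted 𝔬 (k + n)),
      S.specialize f' z = S.specialize f x ∧ S.specialize g' z = S.specialize g x' := by
  obtain ⟨N, f₁, g₁, u, v, hf, hg⟩ : ∃ (N : ℕ) (f₁ g₁ : restricted 𝔬 (N + n))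
      (u v : Fin N → R), S.specialize f₁ u = S.specialize f x ∧
        S.specialize g₁ v = S.specialize g x' := by
    obtain ⟨f₁, u, hf, -⟩ := S.exists_pad f x m'
    obtain ⟨g₁, v, hg⟩ : ∃ (g₁ : restricted 𝔬 (m + m' + n)) (v : Fin (m + m') → R),
        S.specialize g₁ v = S.specialize g x' := by
      rw [Nat.add_comm m m']
      obtain ⟨g₁, v, hg, -⟩ := S.exists_pad g x' m
      exact ⟨g₁, v, hg⟩
    exact ⟨m + m', f₁, g₁, u, v, hf, hg⟩
  refine ⟨N + N, Fin.append u v,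
    renameVars 𝔬 (padEmb n (Fin.castAddEmb N (n := N))) f₁,
    renameVars 𝔬 (padEmb n (Fin.natAddEmb N (m := N))) g₁, ?_, ?_⟩
  · rw [← hf, S.specialize_rename _ _ (fun h => S.iota_castAdd _ _ h _)]
    congr 1
    ext i
    simp
  · rw [← hg, S.specialize_rename _ _ (fun h => (S.iota_shift _ h _).symm)]
    congr 1
    ext i
    exact Fin.append_right u v i

/-- The ring `R⟨Y⟩ = R⟨Y₁, …, Yₙ⟩`, consisting of the series `f(x, Y) ∈ R[[Y]]` with `m ∈ ℕ`,
`f ∈ A⟨X₁, …, Xₘ, Y₁, …, Yₙ⟩` and `x ∈ R ^ m`. -/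
def series (S : AnalyticStructure 𝔬 R) (n : ℕ) : Subring (MvPowerSeries (Fin n) R) where
  carrier := {g | ∃ (m : ℕ) (f : restricted 𝔬 (m + n)) (x : Fin m → R), S.specialize f x = g}
  zero_mem' := ⟨1, _, fun _ => 0, (S.specialize_const 0).trans (map_zero _)⟩
  one_mem' := ⟨1, _, fun _ => 1, (S.specialize_const 1).trans (map_one _)⟩
  add_mem' := by
    rintro _ _ ⟨m, f, x, rfl⟩ ⟨m', g, x', rfl⟩
    obtain ⟨k, z, f', g', hf, hg⟩ := S.exists_common f x g x'
    exact ⟨k, f' + g', z, by rw [specialize_add, hf, hg]⟩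
  mul_mem' := by
    rintro _ _ ⟨m, f, x, rfl⟩ ⟨m', g, x', rfl⟩
    obtain ⟨k, z, f', g', hf, hg⟩ := S.exists_common f x g x'
    exact ⟨k, f' * g', z, by rw [specialize_mul, hf, hg]⟩
  neg_mem' := by
    rintro _ ⟨m, f, x, rfl⟩
    refine ⟨m, -f, x, ?_⟩
    have h : S.specialize (-f + f) x = 0 := by
      rw [neg_add_cancel]
      ext ν
      have : slice (0 : restricted 𝔬 (m + n)) ν = 0 := rfl
      rw [coeff_specialize, this, map_zero, Pi.zero_apply, map_zero]
    rw [specialize_add] at h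
    exact eq_neg_of_add_eq_zero_left h

lemma C_mem_series (S : AnalyticStructure 𝔬 R) (n : ℕ) (a : R) :
    (C a : MvPowerSeries (Fin n) R) ∈ S.series n :=
  ⟨1, _, fun _ => a, S.specialize_const a⟩

section Fractions

variable [IsDomain R]

/-- The `K`-algebra `K⟨Y⟩ = {c⁻¹ g : c ∈ R ∖ {0}, g ∈ R⟨Y⟩} ⊆ K[[Y]]`, where `K` is the fraction
field of `R`. -/
def fracSeries (S : AnalyticStructure 𝔬 R) (K : Type*) [Field K] [Algebra R K]
    [IsFractionRing R K] (n : ℕ) : Subalgebra K (MvPowerSeries (Fin n) K) where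
  carrier := {f | ∃ c : R, c ≠ 0 ∧ ∃ g ∈ S.series n,
    f = (algebraMap R K c)⁻¹ • MvPowerSeries.map (algebraMap R K) g}
  algebraMap_mem' k := by
    obtain ⟨a, b, hb, rfl⟩ := IsFractionRing.div_surjective (A := R) k
    refine ⟨b, nonZeroDivisors.ne_zero hb, C a, S.C_mem_series n a, ?_⟩
    rw [map_C, MvPowerSeries.algebraMap_apply, Algebra.algebraMap_self_apply, smul_eq_C_mul,
      ← map_mul, div_eq_inv_mul]
  add_mem' := by
    rintro _ _ ⟨c, hc, g, hg, rfl⟩ ⟨d, hd, h, hh, rfl⟩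
    have hc' : algebraMap R K c ≠ 0 := by simpa using hc
    have hd' : algebraMap R K d ≠ 0 := by simpa using hd
    refine ⟨c * d, mul_ne_zero hc hd, C d * g + C c * h,
      add_mem (mul_mem (S.C_mem_series n d) hg) (mul_mem (S.C_mem_series n c) hh), ?_⟩
    simp only [map_add, map_mul, map_C]
    rw [← smul_eq_C_mul, ← smul_eq_C_mul, smul_add,
      smul_smul, smul_smul]
    congr 2 <;> field_simp
  mul_mem' := by
    rintro _ _ ⟨c, hc, g, hg, rfl⟩ ⟨d, hd, h, hh, rfl⟩
    refine ⟨c * d, mul_ne_zero hc hd, g * h, mul_mem hg hh, ?_⟩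
    rw [map_mul, map_mul, smul_mul_smul_comm, mul_inv]

/-- `S.HasValueAt g y z` says that `z` is the value `g(y)`, in the fraction field `K` of `R`, of
`g ∈ K⟨Y⟩` at `y ∈ R ^ n`: for `g = c⁻¹ f(x, Y)` with `c ∈ R ∖ {0}`, `f ∈ A⟨X, Y⟩` and `x ∈ R ^ m`
this value is `c⁻¹ f(x, y)`. -/
def HasValueAt (S : AnalyticStructure 𝔬 R) {K : Type*} [Field K] [Algebra R K]
    [IsFractionRing R K] {n : ℕ} (g : MvPowerSeries (Fin n) K) (y : Fin n → R) (z : K) : Prop :=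
  ∃ c : R, c ≠ 0 ∧ ∃ (m : ℕ) (f : restricted 𝔬 (m + n)) (x : Fin m → R),
    g = (algebraMap R K c)⁻¹ • MvPowerSeries.map (algebraMap R K) (S.specialize f x) ∧
    z = (algebraMap R K c)⁻¹ * algebraMap R K (S.iota (m + n) f (Fin.append x y))

end Fractions

end AnalyticStructure

end AnalyticRing

namespace AnalyticRing

open MvPowerSeries

/-! ### The `𝔬`-adic topology of `A⟨Y⟩`: powers of `𝔬` and completeness. -/

section RestrictedAlgebra

variable {A : Type*} [CommRing A] {𝔬 : Ideal A} {n : ℕ}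

/-! The ring `R` need be neither noetherian nor `𝔬`-adically separated, so limit arguments are not
available in `R⟨Y⟩` itself. All convergence takes place in the rings `A⟨X, Y⟩`, which are noetherian
and `𝔬`-adically complete. By Krull's theorem all their ideals are closed, in particular the kernels
of the evaluation maps to `R`, to `R⟨Y⟩` and to quotients of `R⟨Y⟩`. Finitely many elements of
`R⟨Y⟩` come from a single `A⟨X, Y⟩` at one parameter tuple, so statements about finitely many
elements are proved there and pushed down.

This gives three tools. Evaluation commutes with substitution (`iota_subst`). A series lies in the
ideal generated by its coefficients (`mem_span_slice`); hence `R⟨Y⟩` has a universal property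
(`exists_series_lift`), and, as one of finitely many elements of a valuation ring divides the
others, a nonzero element of `R⟨Y⟩` is a constant times an element with nonzero reduction
(`exists_eq_mul_red_ne_zero`). Finally there is a form of Nakayama's lemma
(`Evaluation.span_of_span_mod`).

By viability, reduction maps `R⟨Y⟩` onto the polynomial ring `k[Y]` over the residue field, with
kernel `𝔬 R⟨Y⟩`. Let `I` be a proper ideal of `R⟨Y⟩` saturated with respect to nonzero constants,
with reduction `J`. Noether normalization of `k[Y]/J` lifts to `R⟨Y⟩/I` without Weierstrass
division: the universal property lifts the morphism, Nakayama lifts the generators, and scaling with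
saturation gives injectivity (`exists_finite_injective`). The number of variables drops when `I ≠
0`.

Inverting the nonzero constants gives (ii). For (i), induct on `n`: for a nonzero nonunit `f`, the
ring `K⟨Y⟩/(f)` is finite over a `K⟨Y₁, …, Yₛ⟩` with `s < n`. For (iii), enlarge `I` to a maximal
ideal `M`. Normalization then has `s = 0`, so `R⟨Y⟩/(M ∩ R⟨Y⟩)` is finite over `R`. Under a morphism
from `K⟨Y⟩/M` to the algebraically closed field, the indeterminates have images integral over `R`,
hence in its valuation ring. The morphism is evaluation at that point, since series become
polynomials modulo the integral relations (`ringHom_ext_of_isIntegral`). -/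

noncomputable instance : Algebra A (restricted 𝔬 n) := (constants 𝔬 n).toAlgebra

lemma coe_algebraMap_restricted (a : A) :
    (algebraMap A (restricted 𝔬 n) a : MvPowerSeries (Fin n) A) = C a := rfl

lemma coeff_mem_of_mem_map {J : Ideal A} {f : restricted 𝔬 n}
    (hf : f ∈ J.map (algebraMap A (restricted 𝔬 n))) (ν : Fin n →₀ ℕ) : coeff ν f.1 ∈ J := by
  classical
  induction hf using Submodule.span_induction generalizing ν with
  | mem x hx =>
    obtain ⟨a, ha, rfl⟩ := hx
    rw [coe_algebraMap_restricted, coeff_C]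
    split_ifs
    exacts [ha, zero_mem _]
  | zero => simp
  | add x y _ _ hx hy => simpa using add_mem (hx ν) (hy ν)
  | smul a x _ hx =>
    rw [smul_eq_mul, Subring.coe_mul, coeff_mul]
    exact Ideal.sum_mem _ fun p _ => Ideal.mul_mem_left _ _ (hx p.2)

/-- As `𝔬 ^ e` is finitely generated, all coefficients expand in the same generators; cofactors
chosen small wherever the coefficient is small form restricted series. -/
lemma mem_map_pow_of_coeff_mem [IsNoetherianRing A] {e : ℕ} {f : restricted 𝔬 n}
    (hf : ∀ ν, coeff ν f.1 ∈ 𝔬 ^ e) : f ∈ (𝔬 ^ e).map (algebraMap A (restricted 𝔬 n)) := by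
  classical
  obtain ⟨r, a, ha⟩ := Submodule.fg_iff_exists_fin_generating_family.1
    (IsNoetherian.noetherian (𝔬 ^ e))
  -- `k ν` becomes large outside finite sets of exponents. The cap at the degree is needed because a
  -- coefficient may lie in every power of `𝔬`, for instance if it is zero.
  let k : (Fin n →₀ ℕ) → ℕ := fun ν =>
    Nat.findGreatest (fun j => coeff ν f.1 ∈ 𝔬 ^ (j + e)) ν.degree
  have hk : ∀ ν, coeff ν f.1 ∈ 𝔬 ^ (k ν + e) := fun ν =>
    Nat.findGreatest_spec (P := fun j => coeff ν f.1 ∈ 𝔬 ^ (j + e)) (Nat.zero_le _)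
      (by simpa using hf ν)
  have hc : ∀ ν, ∃ c : Fin r → A, (∀ i, c i ∈ 𝔬 ^ k ν) ∧ ∑ i, c i * a i = coeff ν f.1 := by
    intro ν
    have h := hk ν
    rw [pow_add, ← smul_eq_mul, ← ha, Submodule.mem_ideal_smul_span_iff_exists_sum] at h
    obtain ⟨c, hc, h⟩ := h
    refine ⟨c, hc, ?_⟩
    rw [← h, Finsupp.sum_fintype _ _ (by simp)]
    simp
  choose c hc hcf using hc
  have hg : ∀ i, (fun ν => c ν i : MvPowerSeries (Fin n) A) ∈ restricted 𝔬 n := by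
    intro i K
    refine ((Finsupp.finite_of_degree_le (σ := Fin n) K).union (f.2 (K + e))).subset fun ν hν => ?_
    by_contra h
    simp only [Set.mem_union, Set.mem_ofPred_eq, not_or, not_not, not_le] at h
    exact hν (Ideal.pow_le_pow_right (Nat.le_findGreatest h.1.le h.2) (hc ν i))
  have hsum : f = ∑ i, algebraMap A (restricted 𝔬 n) (a i) * ⟨_, hg i⟩ := by
    apply Subtype.ext
    ext ν
    rw [AddSubmonoidClass.coe_finsetSum, map_sum, ← hcf ν]
    refine Finset.sum_congr rfl fun i _ => ?_
    rw [Subring.coe_mul, coe_algebraMap_restricted, coeff_C_mul, mul_comm]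
    rfl
  rw [hsum]
  refine Ideal.sum_mem _ fun i _ => Ideal.mul_mem_right _ _ (Ideal.mem_map_of_mem _ ?_)
  rw [← ha]
  exact Submodule.subset_span ⟨i, rfl⟩

lemma mem_map_pow_iff [IsNoetherianRing A] {e : ℕ} {f : restricted 𝔬 n} :
    f ∈ (𝔬 ^ e).map (algebraMap A (restricted 𝔬 n)) ↔ ∀ ν, coeff ν f.1 ∈ 𝔬 ^ e :=
  ⟨coeff_mem_of_mem_map, mem_map_pow_of_coeff_mem⟩

lemma mem_pow_smul_top_iff [IsNoetherianRing A] {e : ℕ} {f : restricted 𝔬 n} :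
    f ∈ (𝔬 ^ e • ⊤ : Submodule A (restricted 𝔬 n)) ↔ ∀ ν, coeff ν f.1 ∈ 𝔬 ^ e := by
  rw [Ideal.smul_top_eq_map, Submodule.restrictScalars_mem, mem_map_pow_iff]

variable [IsNoetherianRing A] [IsAdicComplete 𝔬 A]

instance : IsHausdorff 𝔬 (restricted 𝔬 n) where
  haus' f hf := by
    apply Subtype.ext
    ext ν
    refine IsHausdorff.haus (inferInstance : IsHausdorff 𝔬 A) _ fun e => ?_
    have := hf e
    rw [SModEq.zero, mem_pow_smul_top_iff] at this
    rw [SModEq.zero]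
    simpa using this ν

instance : IsPrecomplete 𝔬 (restricted 𝔬 n) where
  prec' F hF := by
    have hF' : ∀ {i j : ℕ}, i ≤ j → ∀ ν, coeff ν (F i).1 - coeff ν (F j).1 ∈ 𝔬 ^ i := by
      intro i j hij ν
      have := hF hij
      rw [SModEq.sub_mem, mem_pow_smul_top_iff] at this
      simpa using this ν
    have hL : ∀ ν, ∃ l : A, ∀ i, coeff ν (F i).1 - l ∈ 𝔬 ^ i := by
      intro ν
      obtain ⟨l, hl⟩ := IsPrecomplete.prec (inferInstance : IsPrecomplete 𝔬 A)
        (f := fun i => coeff ν (F i).1) fun {i j} hij => by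
          rw [SModEq.sub_mem]
          simpa using hF' hij ν
      refine ⟨l, fun i => ?_⟩
      have := hl i
      rw [SModEq.sub_mem] at this
      simpa using this
    choose l hl using hL
    have hmem : (fun ν => l ν : MvPowerSeries (Fin n) A) ∈ restricted 𝔬 n := by
      intro e
      refine ((F e).2 e).subset fun ν hν h => hν ?_
      have := sub_mem h (hl ν e)
      rwa [sub_sub_cancel] at this
    refine ⟨⟨_, hmem⟩, fun e => ?_⟩
    rw [SModEq.sub_mem, mem_pow_smul_top_iff]
    intro ν
    exact hl ν e

instance : IsAdicComplete 𝔬 (restricted 𝔬 n) where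

instance : IsAdicComplete (𝔬.map (algebraMap A (restricted 𝔬 n))) (restricted 𝔬 n) :=
  (IsAdicComplete.map_algebraMap_iff _ _).2 inferInstance

end RestrictedAlgebra

/-! ### Density of polynomials; uniqueness and existence of substitutions. -/

section Polynomials

variable {A : Type*} [CommRing A] {𝔬 : Ideal A} {n : ℕ}

lemma coe_aeval_indet (p : MvPolynomial (Fin n) A) :
    (MvPolynomial.aeval (indet 𝔬 (n := n)) p : MvPowerSeries (Fin n) A) = p := by
  have : (restricted 𝔬 n).subtype.comp
      (MvPolynomial.aeval (indet 𝔬 (n := n)) : _ →ₐ[A] restricted 𝔬 n).toRingHom =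
      MvPolynomial.coeToMvPowerSeries.ringHom := by
    apply MvPolynomial.ringHom_ext
    · intro a
      simp [coe_algebraMap_restricted]
    · intro i
      simp [indet]
  exact congrArg (fun φ => φ p) this

/-- The truncation of a restricted series to a finite set of monomials. -/
noncomputable def truncate (f : restricted 𝔬 n) (s : Finset (Fin n →₀ ℕ)) :
    MvPolynomial (Fin n) A :=
  ∑ ν ∈ s, MvPolynomial.monomial ν (coeff ν f.1)

lemma coeff_truncate (f : restricted 𝔬 n) (s : Finset (Fin n →₀ ℕ)) (ν : Fin n →₀ ℕ)
    [Decidable (ν ∈ s)] :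
    MvPolynomial.coeff ν (truncate f s) = if ν ∈ s then coeff ν f.1 else 0 := by
  classical
  simp [truncate, MvPolynomial.coeff_sum, MvPolynomial.coeff_monomial]

variable [IsNoetherianRing A]

lemma sub_truncate_mem (f : restricted 𝔬 n) (e : ℕ) :
    f - MvPolynomial.aeval (indet 𝔬) (truncate f (f.2 e).toFinset) ∈
      (𝔬 ^ e).map (algebraMap A (restricted 𝔬 n)) := by
  classical
  rw [mem_map_pow_iff]
  intro ν
  rw [AddSubgroupClass.coe_sub, map_sub, coe_aeval_indet, MvPolynomial.coeff_coe, coeff_truncate]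
  split_ifs with h
  · simp
  · simpa using h

lemma exists_polynomial_sub_mem (f : restricted 𝔬 n) (e : ℕ) : ∃ p : MvPolynomial (Fin n) A,
    f - MvPolynomial.aeval (indet 𝔬) p ∈ (𝔬 ^ e).map (algebraMap A (restricted 𝔬 n)) :=
  ⟨_, sub_truncate_mem f e⟩

end Polynomials

section Uniqueness

variable {A : Type*} [CommRing A] [IsNoetherianRing A] {𝔬 : Ideal A} {n : ℕ}

/-- Algebra morphisms are automatically `𝔬`-adically continuous and polynomials are dense. Only
separatedness of the target is needed, so this applies to quotients of `A⟨Y⟩`. -/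
lemma ringHom_restricted_ext {Q : Type*} [CommRing Q] [Algebra A Q]
    [IsHausdorff (𝔬.map (algebraMap A Q)) Q] {φ ψ : restricted 𝔬 n →ₐ[A] Q}
    (h : ∀ i, φ (indet 𝔬 i) = ψ (indet 𝔬 i)) : φ = ψ := by
  ext f
  rw [← sub_eq_zero]
  refine IsHausdorff.haus (inferInstance : IsHausdorff (𝔬.map (algebraMap A Q)) Q) _ fun e => ?_
  rw [SModEq.zero, smul_eq_mul, Ideal.mul_top, ← Ideal.map_pow]
  obtain ⟨p, hp⟩ := exists_polynomial_sub_mem f e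
  have key : ∀ χ : restricted 𝔬 n →ₐ[A] Q,
      χ f - χ (MvPolynomial.aeval (indet 𝔬) p) ∈ (𝔬 ^ e).map (algebraMap A Q) := by
    intro χ
    have := Ideal.mem_map_of_mem χ hp
    rw [← Ideal.map_coe χ, Ideal.map_map, map_sub] at this
    convert this using 2
    ext a
    simp
  have h2 : φ (MvPolynomial.aeval (indet 𝔬) p) = ψ (MvPolynomial.aeval (indet 𝔬) p) := by
    change (φ.comp (MvPolynomial.aeval (indet 𝔬))) p = (ψ.comp (MvPolynomial.aeval (indet 𝔬))) p
    congr 1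
    ext i
    simpa using h i
  have := sub_mem (key φ) (key ψ)
  rwa [h2, sub_sub_sub_cancel_right] at this

end Uniqueness

section Substitution

variable {A : Type*} [CommRing A] [IsNoetherianRing A] {𝔬 : Ideal A} [IsAdicComplete 𝔬 A]
  {m n : ℕ}

variable (𝔬 n) in
/-- The ideal `𝔬 A⟨Y⟩` of `A⟨Y⟩`. -/
noncomputable abbrev extIdeal : Ideal (restricted 𝔬 n) := 𝔬.map (algebraMap A (restricted 𝔬 n))

omit [IsAdicComplete 𝔬 A] in
lemma mk_aeval_surjective (e : ℕ) : Function.Surjective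
    ((Ideal.Quotient.mkₐ A (extIdeal 𝔬 n ^ e)).comp (MvPolynomial.aeval (indet 𝔬 (n := n)))) := by
  intro x
  obtain ⟨f, rfl⟩ := Ideal.Quotient.mk_surjective x
  obtain ⟨p, hp⟩ := exists_polynomial_sub_mem f e
  refine ⟨p, ?_⟩
  symm
  rw [AlgHom.comp_apply, Ideal.Quotient.mkₐ_eq_mk, Ideal.Quotient.eq]
  rwa [Ideal.map_pow] at hp

/-- Makes evaluation at `c` well defined modulo `𝔬 ^ e`: a polynomial that is divisible by `𝔬 ^ e`
as a series has its coefficients in `𝔬 ^ e`. -/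
lemma ker_mk_aeval_le {Q : Type*} [CommRing Q] [Algebra A Q] (e : ℕ) (c : Fin n → Q) :
    RingHom.ker ((Ideal.Quotient.mkₐ A (extIdeal 𝔬 n ^ e)).comp
      (MvPolynomial.aeval (indet 𝔬 (n := n)))).toRingHom ≤
    RingHom.ker ((Ideal.Quotient.mkₐ A (𝔬.map (algebraMap A Q) ^ e)).comp
      (MvPolynomial.aeval c)).toRingHom := by
  intro p hp
  change (Ideal.Quotient.mk _) (MvPolynomial.aeval (indet 𝔬 (n := n)) p) = 0 at hp
  change (Ideal.Quotient.mk _) (MvPolynomial.aeval c p) = 0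
  rw [Ideal.Quotient.eq_zero_iff_mem, ← Ideal.map_pow] at hp ⊢
  rw [mem_map_pow_iff] at hp
  have h2 : p ∈ Ideal.map MvPolynomial.C (𝔬 ^ e) := by
    rw [MvPolynomial.mem_map_C_iff]
    intro ν
    simpa [coe_aeval_indet] using hp ν
  have := Ideal.mem_map_of_mem (MvPolynomial.aeval c : _ →ₐ[A] Q).toRingHom h2
  rw [Ideal.map_map] at this
  have hc : (MvPolynomial.aeval c : _ →ₐ[A] Q).toRingHom.comp MvPolynomial.C = algebraMap A Q := by
    ext a
    simp
  rwa [hc] at this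

/-- Modulo `𝔬 ^ e` every series is a polynomial, which can be evaluated at `c`; the resulting
compatible maps lift to the complete ring `Q`. -/
lemma exists_subst {Q : Type*} [CommRing Q] [Algebra A Q]
    [IsAdicComplete (𝔬.map (algebraMap A Q)) Q] (c : Fin n → Q) :
    ∃ φ : restricted 𝔬 n →ₐ[A] Q, ∀ i, φ (indet 𝔬 i) = c i := by
  let 𝔪 := 𝔬.map (algebraMap A Q)
  let φ : ∀ e : ℕ, (restricted 𝔬 n ⧸ extIdeal 𝔬 n ^ e) →ₐ[A] Q ⧸ 𝔪 ^ e := fun e =>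
    AlgHom.liftOfSurjective _ (mk_aeval_surjective e) _ (ker_mk_aeval_le e c)
  have hφ : ∀ e p, φ e (Ideal.Quotient.mk _ (MvPolynomial.aeval (indet 𝔬) p)) =
      Ideal.Quotient.mk _ (MvPolynomial.aeval c p) := fun e p =>
    AlgHom.liftOfSurjective_apply _ (mk_aeval_surjective e) _ (ker_mk_aeval_le e c) p
  let f : ∀ e : ℕ, restricted 𝔬 n →ₐ[A] Q ⧸ 𝔪 ^ e := fun e =>
    (φ e).comp (Ideal.Quotient.mkₐ A _)
  have hf : ∀ {i j : ℕ} (hij : i ≤ j),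
      (Ideal.Quotient.factorₐ A (Ideal.pow_le_pow_right hij)).comp (f j) = f i := by
    intro i j hij
    ext g
    obtain ⟨p, hp⟩ := exists_polynomial_sub_mem g j
    have h1 : ∀ k, k ≤ j → f k g = Ideal.Quotient.mk _ (MvPolynomial.aeval c p) := by
      intro k hk
      rw [← hφ]
      change φ k (Ideal.Quotient.mk _ g) = _
      congr 1
      rw [Ideal.Quotient.eq, ← Ideal.map_pow]
      exact Ideal.map_mono (Ideal.pow_le_pow_right hk) hp
    rw [AlgHom.comp_apply, h1 j le_rfl, h1 i hij]
    rfl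
  refine ⟨IsAdicComplete.liftAlgHom 𝔪 f hf, fun i => ?_⟩
  rw [← sub_eq_zero]
  refine IsHausdorff.haus (inferInstance : IsHausdorff 𝔪 Q) _ fun e => ?_
  rw [SModEq.zero, smul_eq_mul, Ideal.mul_top, ← Ideal.Quotient.eq]
  rw [IsAdicComplete.mk_liftAlgHom]
  have := hφ e (MvPolynomial.X i)
  rwa [MvPolynomial.aeval_X, MvPolynomial.aeval_X] at this

/-- Substitution `F ↦ F(c₁, …, c_N)` of restricted series into restricted series. -/
noncomputable def subst (c : Fin n → restricted 𝔬 m) : restricted 𝔬 n →ₐ[A] restricted 𝔬 m :=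
  (exists_subst c).choose

@[simp]
lemma subst_indet (c : Fin n → restricted 𝔬 m) (i : Fin n) : subst c (indet 𝔬 i) = c i :=
  (exists_subst c).choose_spec i

lemma algHom_restricted_ext {φ ψ : restricted 𝔬 n →ₐ[A] restricted 𝔬 m}
    (h : ∀ i, φ (indet 𝔬 i) = ψ (indet 𝔬 i)) : φ = ψ :=
  ringHom_restricted_ext h

lemma algHom_comp_subst {k : ℕ} (φ : restricted 𝔬 m →ₐ[A] restricted 𝔬 k)
    (c : Fin n → restricted 𝔬 m) (f : restricted 𝔬 n) :
    φ (subst c f) = subst (fun i => φ (c i)) f := by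
  have : φ.comp (subst c) = subst (fun i => φ (c i)) := algHom_restricted_ext (by simp)
  exact congrArg (fun ψ => ψ f) this

/-- `renameVars` as a morphism of algebras. -/
noncomputable def renameHom (e : Fin m ↪ Fin n) : restricted 𝔬 m →ₐ[A] restricted 𝔬 n where
  toRingHom := renameVars 𝔬 e
  commutes' a := by
    apply Subtype.ext
    change rename e (C a) = C a
    rw [rename_C]

omit [IsNoetherianRing A] [IsAdicComplete 𝔬 A] in
@[simp]
lemma renameHom_indet (e : Fin m ↪ Fin n) (i : Fin m) :
    renameHom e (indet 𝔬 i) = indet 𝔬 (e i) := by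
  apply Subtype.ext
  change rename e (X i) = X (e i)
  rw [rename_X]

omit [IsNoetherianRing A] [IsAdicComplete 𝔬 A] in
lemma renameHom_apply (e : Fin m ↪ Fin n) (f : restricted 𝔬 m) :
    renameHom e f = renameVars 𝔬 e f := rfl

lemma renameHom_eq_subst (e : Fin m ↪ Fin n) :
    renameHom (𝔬 := 𝔬) e = subst fun i => indet 𝔬 (e i) :=
  algHom_restricted_ext (by simp)

end Substitution

/-! ### Noetherianity of `A⟨Y⟩` and closedness of its ideals. -/

section Noetherian

lemma exists_lift_adicCompletion {P B : Type*} [CommRing P] [CommRing B] {J : Ideal P}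
    {𝔟 : Ideal B} [IsAdicComplete 𝔟 B] (g : P →+* B) (hg : J.map g ≤ 𝔟) :
    ∃ φ : AdicCompletion J P →+* B, ∀ p, φ (algebraMap P _ p) = g p := by
  have hle : ∀ e, J ^ e ≤ (𝔟 ^ e).comap g := fun e => by
    rw [← Ideal.map_le_iff_le_comap, Ideal.map_pow]
    exact Ideal.pow_right_mono hg e
  let f : ∀ e : ℕ, AdicCompletion J P →+* B ⧸ 𝔟 ^ e := fun e =>
    (Ideal.quotientMap (𝔟 ^ e) g (hle e)).comp (AdicCompletion.evalₐ J e : _ →+* _)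
  have hf : ∀ {i j : ℕ} (hij : i ≤ j), (Ideal.Quotient.factorPow 𝔟 hij).comp (f j) = f i := by
    intro i j hij
    ext x
    obtain ⟨x, rfl⟩ := AdicCompletion.mk_surjective J P x
    simp only [f, RingHom.comp_apply, RingHom.coe_coe, AdicCompletion.evalₐ_mk,
      Ideal.quotientMap_mk]
    change Ideal.Quotient.mk (𝔟 ^ i) _ = _
    refine Ideal.Quotient.eq.2 ?_
    rw [← map_sub]
    refine hle i ?_
    have := x.2 hij
    rw [SModEq.sub_mem, smul_eq_mul, Ideal.mul_top] at this
    rw [← neg_sub]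
    exact neg_mem this
  refine ⟨IsAdicComplete.liftRingHom 𝔟 f hf, fun p => ?_⟩
  rw [← sub_eq_zero]
  refine IsHausdorff.haus (inferInstance : IsHausdorff 𝔟 B) _ fun e => ?_
  rw [SModEq.zero, smul_eq_mul, Ideal.mul_top, ← Ideal.Quotient.eq,
    IsAdicComplete.mk_liftRingHom]
  simp [f]

/-- `B` is a quotient of a power series ring over `P`, with variables sent to generators of `𝔟`. The
power series ring appears as the completion of a polynomial ring along its variables, and
surjectivity is checked modulo `𝔟`. -/
lemma isNoetherianRing_of_isAdicComplete {P B : Type*} [CommRing P] [CommRing B]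
    [IsNoetherianRing P] {𝔟 : Ideal B} [IsAdicComplete 𝔟 B] (hfg : 𝔟.FG) (g : P →+* B)
    (hg : Function.Surjective ((Ideal.Quotient.mk 𝔟).comp g)) : IsNoetherianRing B := by
  obtain ⟨r, a, ha⟩ := Submodule.fg_iff_exists_fin_generating_family.1 hfg
  let J := MvPolynomial.idealOfVars (Fin r) P
  let g' : MvPolynomial (Fin r) P →+* B := MvPolynomial.eval₂Hom g a
  have hJ : J.map g' = 𝔟 := by
    rw [← ha]
    simp only [J, MvPolynomial.idealOfVars, Ideal.map_span, ← Set.range_comp]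
    congr 1
    ext x
    simp [g']
  obtain ⟨φ, hφ⟩ := exists_lift_adicCompletion (𝔟 := 𝔟) g' hJ.le
  have hφ' : φ.comp (algebraMap _ _) = g' := RingHom.ext hφ
  have hmap : (J.map (algebraMap _ (AdicCompletion J (MvPolynomial (Fin r) P)))).map φ = 𝔟 := by
    rw [Ideal.map_map, hφ', hJ]
  have : IsAdicComplete (J.map (algebraMap _ (AdicCompletion J (MvPolynomial (Fin r) P))))
      (AdicCompletion J (MvPolynomial (Fin r) P)) := by
    rw [IsAdicComplete.map_algebraMap_iff]
    exact AdicCompletion.isAdicComplete (MvPolynomial.idealOfVars_fg _ _)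
  have : IsHausdorff ((J.map (algebraMap _ (AdicCompletion J (MvPolynomial (Fin r) P)))).map φ)
      B := by
    rw [hmap]
    infer_instance
  have : IsNoetherianRing (AdicCompletion J (MvPolynomial (Fin r) P)) :=
    isNoetherianRing_of_ringEquiv _ (toAdicCompletionAlgEquiv (Fin r) P).toRingEquiv
  refine isNoetherianRing_of_surjective _ _ φ (surjective_of_mk_map_comp_surjective
    (I := J.map (algebraMap _ (AdicCompletion J (MvPolynomial (Fin r) P)))) φ ?_)
  intro x
  obtain ⟨b, rfl⟩ := Ideal.Quotient.mk_surjective x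
  obtain ⟨p, hp⟩ := hg (Ideal.Quotient.mk _ b)
  refine ⟨algebraMap (MvPolynomial (Fin r) P) _ (MvPolynomial.C p), ?_⟩
  rw [RingHom.comp_apply, hφ, Ideal.Quotient.eq, hmap, ← Ideal.Quotient.eq]
  simpa [g'] using hp

variable {A : Type*} [CommRing A] [IsNoetherianRing A] {𝔬 : Ideal A} [IsAdicComplete 𝔬 A]
  {m n : ℕ}

instance : IsNoetherianRing (restricted 𝔬 n) := by
  refine isNoetherianRing_of_isAdicComplete (𝔟 := extIdeal 𝔬 n)
    (Ideal.FG.map (IsNoetherian.noetherian 𝔬) _)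
    (MvPolynomial.aeval (indet 𝔬 (n := n)) : _ →ₐ[A] _).toRingHom fun x => ?_
  obtain ⟨f, rfl⟩ := Ideal.Quotient.mk_surjective x
  obtain ⟨p, hp⟩ := exists_polynomial_sub_mem f 1
  refine ⟨p, ?_⟩
  symm
  rw [RingHom.comp_apply, Ideal.Quotient.eq]
  rwa [pow_one] at hp

/-- Krull's intersection theorem: in the complete noetherian ring `A⟨Y⟩` the ideal `𝔬 A⟨Y⟩` lies in
the Jacobson radical, so every ideal is closed. -/
lemma isHausdorff_quotient (J : Ideal (restricted 𝔬 n)) :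
    IsHausdorff 𝔬 (restricted 𝔬 n ⧸ J) := by
  have h : extIdeal 𝔬 n ≤ Ideal.jacobson ⊥ := IsAdicComplete.le_jacobson_bot _
  exact IsHausdorff.map_algebraMap_iff.1
    (IsHausdorff.of_le_jacobson (extIdeal 𝔬 n) (restricted 𝔬 n ⧸ J) h)

instance (J : Ideal (restricted 𝔬 n)) :
    IsHausdorff (𝔬.map (algebraMap A (restricted 𝔬 n ⧸ J))) (restricted 𝔬 n ⧸ J) :=
  IsHausdorff.map_algebraMap_iff.2 (isHausdorff_quotient J)

/-- Used with `J` the kernel of an evaluation map: identities between values then pass from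
indeterminates to all series, even when the ring of values is not separated. -/
lemma algHom_sub_mem (φ ψ : restricted 𝔬 m →ₐ[A] restricted 𝔬 n) (J : Ideal (restricted 𝔬 n))
    (h : ∀ i, φ (indet 𝔬 i) - ψ (indet 𝔬 i) ∈ J) (f : restricted 𝔬 m) : φ f - ψ f ∈ J := by
  have : (Ideal.Quotient.mkₐ A J).comp φ = (Ideal.Quotient.mkₐ A J).comp ψ :=
    ringHom_restricted_ext fun i => Ideal.Quotient.eq.2 (h i)
  exact Ideal.Quotient.eq.1 (congrArg (fun χ => χ f) this)

end Noetherian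

/-! ### Expansion of a series in `A⟨X, Y⟩` by its coefficients in `A⟨X⟩`. -/

section Slices

variable {A : Type*} [CommRing A] {𝔬 : Ideal A} {m n : ℕ}

/-- Taking the coefficient `f_ν(X)` of `f(X, Y)`, as an additive morphism. -/
noncomputable def sliceHom (ν : Fin n →₀ ℕ) : restricted 𝔬 (m + n) →+ restricted 𝔬 m :=
  AddMonoidHom.mk' (fun f => slice f ν) fun f g => slice_add f g ν

lemma sliceHom_apply (ν : Fin n →₀ ℕ) (f : restricted 𝔬 (m + n)) : sliceHom ν f = slice f ν := rfl

lemma joinExp_zero_right (μ : Fin m →₀ ℕ) :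
    joinExp μ (0 : Fin n →₀ ℕ) = Finsupp.embDomain (Fin.castAddEmb n) μ := by
  ext i
  refine Fin.addCases (fun i => ?_) (fun i => ?_) i
  · have : Finsupp.embDomain (Fin.castAddEmb n) μ (Fin.castAddEmb n i) = μ i :=
      Finsupp.embDomain_apply_self _ _ _
    simpa [joinExp] using this.symm
  · rw [Finsupp.embDomain_of_notMem_range]
    · simp [joinExp]
    · rintro ⟨k, hk⟩
      have := congrArg Fin.val hk
      simp at this
      omega

lemma slice_renameHom_castAdd (g : restricted 𝔬 m) (ν : Fin n →₀ ℕ) [Decidable (ν = 0)] :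
    slice (renameHom (Fin.castAddEmb n) g) ν = if ν = 0 then g else 0 := by
  apply Subtype.ext
  ext μ
  change coeff (joinExp μ ν) (rename (Fin.castAddEmb n) g.1) = _
  split_ifs with h
  · subst h
    rw [joinExp_zero_right, coeff_embDomain_rename]
  · rw [coeff_rename_eq_zero]
    · rfl
    · rintro ⟨κ, hκ⟩
      rw [← Finsupp.embDomain_eq_mapDomain, ← joinExp_zero_right, joinExp_inj] at hκ
      exact h hκ.2.symm

/-- The monomial `Y ^ ν` in `A⟨X, Y⟩`. -/
noncomputable def monomialY (𝔬 : Ideal A) (m : ℕ) (ν : Fin n →₀ ℕ) : restricted 𝔬 (m + n) :=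
  ∏ l, indet 𝔬 (Fin.natAdd m l) ^ ν l

lemma coe_monomialY (ν : Fin n →₀ ℕ) :
    (monomialY 𝔬 m ν : MvPowerSeries (Fin (m + n)) A) = monomial (joinExp 0 ν) 1 := by
  have h : monomialY 𝔬 m ν =
      MvPolynomial.aeval (indet 𝔬) (MvPolynomial.monomial (joinExp (0 : Fin m →₀ ℕ) ν) (1 : A)) := by
    rw [MvPolynomial.aeval_monomial, map_one, one_mul, Finsupp.prod_fintype _ _ (by simp),
      Fin.prod_univ_add]
    simp [joinExp, monomialY]
  rw [h, coe_aeval_indet, MvPolynomial.coe_monomial]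

lemma slice_monomialY (ν ν' : Fin n →₀ ℕ) [Decidable (ν' = ν)] :
    slice (monomialY 𝔬 m ν) ν' = if ν' = ν then 1 else 0 := by
  classical
  apply Subtype.ext
  ext μ
  change coeff (joinExp μ ν') (monomialY 𝔬 m ν).1 = _
  rw [coe_monomialY, coeff_monomial]
  simp only [joinExp_inj]
  by_cases h : ν' = ν
  · simp [h, coeff_one]
  · simp [h]

lemma slice_renameHom_mul_monomialY (g : restricted 𝔬 m) (ν ν' : Fin n →₀ ℕ)
    [Decidable (ν' = ν)] :
    slice (renameHom (Fin.castAddEmb n) g * monomialY 𝔬 m ν) ν' = if ν' = ν then g else 0 := by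
  classical
  rw [slice_mul]
  simp only [slice_renameHom_castAdd, slice_monomialY]
  rw [Finset.sum_eq_single (0, ν')]
  · simp
  · rintro ⟨a, b⟩ hab hne
    by_cases ha : a = 0
    · subst ha
      simp only [Finset.HasAntidiagonal.mem_antidiagonal, zero_add] at hab
      exact absurd (by rw [hab]) hne
    · simp [ha]
  · simp

variable [IsNoetherianRing A]

lemma exists_sub_sum_slice_mem (f : restricted 𝔬 (m + n)) (e : ℕ) :
    ∃ s : Finset (Fin n →₀ ℕ),
      f - ∑ ν ∈ s, renameHom (Fin.castAddEmb n) (slice f ν) * monomialY 𝔬 m ν ∈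
        (𝔬 ^ e).map (algebraMap A (restricted 𝔬 (m + n))) := by
  classical
  have hfin : {ν : Fin n →₀ ℕ | ∃ μ : Fin m →₀ ℕ, coeff (joinExp μ ν) f.1 ∉ 𝔬 ^ e}.Finite := by
    refine ((f.2 e).image fun κ =>
      Finsupp.equivFunOnFinite.symm fun i => κ (Fin.natAdd m i)).subset ?_
    rintro ν ⟨μ, h⟩
    refine ⟨_, h, ?_⟩
    ext i
    simp [joinExp]
  refine ⟨hfin.toFinset, ?_⟩
  rw [mem_map_pow_iff]
  intro κ
  obtain ⟨μ, ν, rfl⟩ := exists_joinExp κ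
  change coeff μ (slice (f - _) ν).1 ∈ _
  rw [← sliceHom_apply, map_sub, map_sum]
  simp only [sliceHom_apply, slice_renameHom_mul_monomialY, Finset.sum_ite_eq]
  split_ifs with h
  · simp
  · simp only [Set.Finite.mem_toFinset, Set.mem_ofPred_eq, not_exists, not_not] at h
    rw [sub_zero]
    exact h μ

/-- A series `f = ∑ f_ν(X) Y ^ ν` lies in the ideal generated by its coefficients `f_ν`. -/
lemma mem_span_slice [IsAdicComplete 𝔬 A] (f : restricted 𝔬 (m + n)) :
    f ∈ Ideal.span (Set.range fun ν => renameHom (Fin.castAddEmb n) (slice f ν)) := by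
  set J := Ideal.span (Set.range fun ν => renameHom (𝔬 := 𝔬) (Fin.castAddEmb n) (slice f ν))
    with hJ
  rw [← Ideal.Quotient.eq_zero_iff_mem]
  -- Since `J` is closed, it suffices to work modulo `𝔬 ^ e`, where `f` is a finite sum of terms
  -- `f_ν Y ^ ν`.
  refine IsHausdorff.haus (isHausdorff_quotient J) _ fun e => ?_
  rw [SModEq.zero, Ideal.smul_top_eq_map, Submodule.restrictScalars_mem]
  obtain ⟨s, hs⟩ := exists_sub_sum_slice_mem f e
  have h1 : ∑ ν ∈ s, renameHom (Fin.castAddEmb n) (slice f ν) * monomialY 𝔬 m ν ∈ J :=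
    Ideal.sum_mem _ fun ν _ => Ideal.mul_mem_right _ _ (Ideal.subset_span ⟨ν, rfl⟩)
  have h2 := Ideal.mem_map_of_mem (Ideal.Quotient.mk J) hs
  rw [map_sub, Ideal.Quotient.eq_zero_iff_mem.2 h1, sub_zero, Ideal.map_map] at h2
  exact h2

end Slices

/-! ### Evaluation of restricted series, and rings generated by parameters. -/

section Evaluation

variable {A : Type*} [CommRing A] [IsNoetherianRing A] {𝔬 : Ideal A} [IsAdicComplete 𝔬 A]

variable (𝔬) in
/-- A ring in which restricted series can be evaluated at arbitrary tuples, compatibly with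
substitution. -/
structure Evaluation (B : Type*) [CommRing B] where
  op : ∀ {N : ℕ}, (Fin N → B) → restricted 𝔬 N →+* B
  op_indet : ∀ {N : ℕ} (b : Fin N → B) (i : Fin N), op b (indet 𝔬 i) = b i
  op_subst : ∀ {M N : ℕ} (b : Fin M → B) (c : Fin N → restricted 𝔬 M) (f : restricted 𝔬 N),
    op b (subst c f) = op (fun i => op b (c i)) f

namespace AnalyticStructure

variable {R : Type*} [CommRing R] (S : AnalyticStructure 𝔬 R)

/-- Evaluation of restricted series at a point. -/
noncomputable def evalAt {N : ℕ} (b : Fin N → R) : restricted 𝔬 N →+* R :=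
  (Pi.evalRingHom _ b).comp (S.iota N)

lemma evalAt_apply {N : ℕ} (b : Fin N → R) (f : restricted 𝔬 N) :
    S.evalAt b f = S.iota N f b := rfl

lemma iota_castLE {m L : ℕ} (h : m ≤ L) (f : restricted 𝔬 m) (x : Fin L → R) :
    S.iota L (renameHom (Fin.castLEEmb h) f) x = S.iota m f fun i => x (Fin.castLE h i) := by
  obtain ⟨k, rfl⟩ := Nat.exists_eq_add_of_le h
  exact S.iota_castAdd m k f x

/-- At the point `(b, c(b))` of `R ^ (2L)` the series `Y_{L+i} - c_i(Y₁, …, Y_L)` vanish. By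
closedness of the kernel of evaluation, so does `f(Y_{L+1}, …, Y_{2L}) - f(c)`. -/
lemma iota_subst_self {L : ℕ} (b : Fin L → R) (c : Fin L → restricted 𝔬 L)
    (f : restricted 𝔬 L) :
    S.iota L (subst c f) b = S.iota L f fun i => S.iota L (c i) b := by
  let z : Fin (L + L) → R := Fin.append b fun i => S.iota L (c i) b
  have hcast : ∀ g, S.evalAt z (renameHom (Fin.castAddEmb L) g) = S.iota L g b := by
    intro g
    rw [evalAt_apply, renameHom_apply, S.iota_castAdd]
    exact congrArg (S.iota L g) (funext fun i => by simp [z])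
  have hnat : ∀ g, S.evalAt z (renameHom (Fin.natAddEmb L) g) =
      S.iota L g fun i => S.iota L (c i) b := by
    intro g
    rw [evalAt_apply, renameHom_apply, ← S.iota_shift]
    exact congrArg (S.iota L g) (funext fun i => Fin.append_right _ _ i)
  have h := algHom_sub_mem (renameHom (𝔬 := 𝔬) (Fin.natAddEmb L))
    ((renameHom (Fin.castAddEmb L)).comp (subst c)) (RingHom.ker (S.evalAt z)) (fun i => ?_) f
  · rw [RingHom.mem_ker, map_sub, sub_eq_zero, hnat] at h
    rw [h, AlgHom.comp_apply, hcast]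
  · rw [RingHom.mem_ker, map_sub, sub_eq_zero, hnat, AlgHom.comp_apply, hcast, subst_indet,
      S.iota_indet]

/-- The shift axiom relates only `n` and `2n` variables, so both tuples are padded to a common
length. The padding zeros are never seen by the series involved. -/
lemma iota_subst {M N : ℕ} (b : Fin M → R) (c : Fin N → restricted 𝔬 M) (f : restricted 𝔬 N) :
    S.iota M (subst c f) b = S.iota N f fun i => S.iota M (c i) b := by
  let L := max M N
  have hM : M ≤ L := le_max_left _ _
  have hN : N ≤ L := le_max_right _ _
  let b' : Fin L → R := fun i => if h : (i : ℕ) < M then b ⟨i, h⟩ else 0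
  let c' : Fin L → restricted 𝔬 L := fun i =>
    if h : (i : ℕ) < N then renameHom (Fin.castLEEmb hM) (c ⟨i, h⟩) else 0
  have hb' : ∀ g : restricted 𝔬 M, S.iota L (renameHom (Fin.castLEEmb hM) g) b' =
      S.iota M g b := by
    intro g
    rw [iota_castLE]
    exact congrArg (S.iota M g) (funext fun i => by simp [b'])
  have h1 := S.iota_subst_self b' c' (renameHom (Fin.castLEEmb hN) f)
  rw [iota_castLE] at h1
  have h2 : (subst c').comp (renameHom (𝔬 := 𝔬) (Fin.castLEEmb hN)) =
      (renameHom (Fin.castLEEmb hM)).comp (subst c) :=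
    algHom_restricted_ext fun i => by simp [c']
  have h3 := congrArg (fun φ => φ f) h2
  simp only [AlgHom.comp_apply] at h3
  rw [h3, hb'] at h1
  rw [h1]
  refine congrArg (S.iota N f) (funext fun i => ?_)
  simp only [c', Fin.val_castLE, Fin.is_lt, dif_pos, Fin.eta]
  exact hb' _

/-- Evaluation of restricted series in a ring with analytic structure. -/
noncomputable def evaluation : Evaluation 𝔬 R where
  op b := S.evalAt b
  op_indet b i := S.iota_indet _ i b
  op_subst b c f := S.iota_subst b c f

end AnalyticStructure

namespace Evaluation

variable {B : Type*} [CommRing B] (T : Evaluation 𝔬 B)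

lemma op_renameHom {M N : ℕ} (e : Fin M ↪ Fin N) (b : Fin N → B) (f : restricted 𝔬 M) :
    T.op b (renameHom e f) = T.op (fun i => b (e i)) f := by
  rw [renameHom_eq_subst, T.op_subst]
  simp only [op_indet]

/-- The structural morphism of a ring with evaluation. -/
noncomputable def struct : A →+* B :=
  (T.op Fin.elim0).comp (algebraMap A (restricted 𝔬 0))

lemma op_algebraMap {N : ℕ} (b : Fin N → B) (a : A) :
    T.op b (algebraMap A (restricted 𝔬 N) a) = T.struct a := by
  have h := T.op_renameHom (Function.Embedding.ofIsEmpty : Fin 0 ↪ Fin N) b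
    (algebraMap A (restricted 𝔬 0) a)
  rw [AlgHom.commutes] at h
  rw [h]
  have : (fun i => b ((Function.Embedding.ofIsEmpty : Fin 0 ↪ Fin N) i)) = Fin.elim0 :=
    Subsingleton.elim _ _
  rw [this]
  rfl

lemma op_mem_map_struct {N : ℕ} (b : Fin N → B) {f : restricted 𝔬 N} (hf : f ∈ extIdeal 𝔬 N) :
    T.op b f ∈ 𝔬.map T.struct := by
  have h := Ideal.mem_map_of_mem (T.op b) hf
  rw [Ideal.map_map] at h
  convert h using 2
  ext a
  exact (T.op_algebraMap b a).symm

/-- Morphisms of rings compatible with the evaluation of restricted series. -/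
def IsHom {B' : Type*} [CommRing B'] (T' : Evaluation 𝔬 B') (φ : B →+* B') : Prop :=
  ∀ {N : ℕ} (b : Fin N → B) (f : restricted 𝔬 N), φ (T.op b f) = T'.op (fun i => φ (b i)) f

lemma IsHom.struct {T : Evaluation 𝔬 B} {B' : Type*} [CommRing B'] {T' : Evaluation 𝔬 B'}
    {φ : B →+* B'} (h : T.IsHom T' φ) (a : A) : φ (T.struct a) = T'.struct a := by
  have h' := h Fin.elim0 (algebraMap A (restricted 𝔬 0) a)
  rwa [op_algebraMap, op_algebraMap] at h'

end Evaluation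

variable (𝔬) in
/-- A family of morphisms `A⟨X, Y⟩ → D`, one for each tuple `x` of parameters in `R` to be
substituted for `X`, compatible with renaming the parameters. -/
structure Presentation (R : Type*) (n : ℕ) (D : Type*) [CommRing D] where
  map : ∀ {m : ℕ}, (Fin m → R) → restricted 𝔬 (m + n) →+* D
  map_rename : ∀ {m m' : ℕ} (e : Fin m ↪ Fin m') (x : Fin m' → R) (f : restricted 𝔬 (m + n)),
    map x (renameHom (padEmb n e) f) = map (fun i => x (e i)) f

namespace Presentation

variable {R : Type*} {n : ℕ} {D : Type*} [CommRing D] (P : Presentation 𝔬 R n D)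

/-- Every element is the value of a series at some parameters. -/
def IsSurj : Prop := ∀ d, ∃ (m : ℕ) (x : Fin m → R) (f : restricted 𝔬 (m + n)), P.map x f = d

lemma map_append_left {m m' : ℕ} (x : Fin m → R) (x' : Fin m' → R) (f : restricted 𝔬 (m + n)) :
    P.map (Fin.append x x') (renameHom (padEmb n (Fin.castAddEmb m')) f) = P.map x f := by
  rw [map_rename]
  congr 2
  ext i
  simp

lemma map_append_right {m m' : ℕ} (x : Fin m → R) (x' : Fin m' → R)
    (f : restricted 𝔬 (m' + n)) :
    P.map (Fin.append x x') (renameHom (padEmb n (Fin.natAddEmb m)) f) = P.map x' f := by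
  rw [map_rename]
  congr 2
  ext i
  simp

variable {P} in
lemma IsSurj.exists_fin (hP : P.IsSurj) {K : ℕ} (d : Fin K → D) :
    ∃ (m : ℕ) (x : Fin m → R) (g : Fin K → restricted 𝔬 (m + n)), ∀ i, P.map x (g i) = d i := by
  induction K with
  | zero => exact ⟨0, Fin.elim0, Fin.elim0, fun i => i.elim0⟩
  | succ K ih =>
    obtain ⟨m, x, g, hg⟩ := ih fun i => d i.castSucc
    obtain ⟨m', x', f, hf⟩ := hP (d (Fin.last K))
    refine ⟨m + m', Fin.append x x', Fin.snoc (α := fun _ => restricted 𝔬 (m + m' + n))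
      (fun i => renameHom (padEmb n (Fin.castAddEmb m')) (g i))
      (renameHom (padEmb n (Fin.natAddEmb m)) f), fun i => ?_⟩
    refine Fin.lastCases ?_ (fun i => ?_) i
    · simp only [Fin.snoc_last]
      rw [map_append_right, hf]
    · simp only [Fin.snoc_castSucc]
      rw [map_append_left, hg]

variable {P} in
lemma IsSurj.exists_finite (hP : P.IsSurj) {ι : Type*} [Finite ι] (d : ι → D) :
    ∃ (m : ℕ) (x : Fin m → R) (g : ι → restricted 𝔬 (m + n)), ∀ i, P.map x (g i) = d i := by
  obtain ⟨K, ⟨ε⟩⟩ := Finite.exists_equiv_fin ι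
  obtain ⟨m, x, g, hg⟩ := hP.exists_fin fun k => d (ε.symm k)
  exact ⟨m, x, fun i => g (ε i), fun i => by simp [hg]⟩

variable {P} in
lemma IsSurj.exists_finite_params (hP : P.IsSurj) {ι κ : Type*} [Finite ι] [Finite κ] (d : ι → D)
    (c : κ → R) : ∃ (m : ℕ) (x : Fin m → R) (g : ι → restricted 𝔬 (m + n)) (idx : κ → Fin m),
      (∀ i, P.map x (g i) = d i) ∧ ∀ k, x (idx k) = c k := by
  obtain ⟨K, ⟨ε⟩⟩ := Finite.exists_equiv_fin κ
  obtain ⟨m, x, g, hg⟩ := hP.exists_finite d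
  refine ⟨m + K, Fin.append x fun k => c (ε.symm k),
    fun i => renameHom (padEmb n (Fin.castAddEmb K)) (g i), fun k => Fin.natAdd m (ε k),
    fun i => ?_, fun k => by simp⟩
  rw [map_append_left, hg]

/-- Makes evaluation in `D` independent of the chosen representatives: with both parameter tuples
put side by side, the differences of representatives lie in one closed kernel. -/
lemma map_subst_eq {m m' N : ℕ} {x : Fin m → R} {x' : Fin m' → R}
    {g : Fin N → restricted 𝔬 (m + n)} {g' : Fin N → restricted 𝔬 (m' + n)}
    (h : ∀ i, P.map x (g i) = P.map x' (g' i)) (f : restricted 𝔬 N) :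
    P.map x (subst g f) = P.map x' (subst g' f) := by
  have key := algHom_sub_mem ((renameHom (padEmb n (Fin.castAddEmb m'))).comp (subst g))
    ((renameHom (padEmb n (Fin.natAddEmb m))).comp (subst g'))
    (RingHom.ker (P.map (Fin.append x x'))) (fun i => ?_) f
  · rwa [RingHom.mem_ker, map_sub, sub_eq_zero, AlgHom.comp_apply, AlgHom.comp_apply,
      map_append_left, map_append_right] at key
  · rw [RingHom.mem_ker, map_sub, sub_eq_zero, AlgHom.comp_apply, AlgHom.comp_apply,
      map_append_left, map_append_right, subst_indet, subst_indet, h]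

variable {P} in
lemma IsSurj.exists_op (hP : P.IsSurj) {N : ℕ} (d : Fin N → D) :
    ∃ φ : restricted 𝔬 N →+* D, ∀ (m : ℕ) (x : Fin m → R) (g : Fin N → restricted 𝔬 (m + n)),
      (∀ i, P.map x (g i) = d i) → ∀ f, φ f = P.map x (subst g f) := by
  obtain ⟨m, x, g, hg⟩ := hP.exists_fin d
  refine ⟨(P.map x).comp (subst g : _ →ₐ[A] _).toRingHom, fun m' x' g' hg' f => ?_⟩
  exact P.map_subst_eq (fun i => (hg i).trans (hg' i).symm) f

/-- Evaluation of a restricted series at a tuple in a ring generated by parameters. -/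
noncomputable def op (hP : P.IsSurj) {N : ℕ} (d : Fin N → D) : restricted 𝔬 N →+* D :=
  (hP.exists_op d).choose

lemma op_eq (hP : P.IsSurj) {m N : ℕ} (x : Fin m → R) (g : Fin N → restricted 𝔬 (m + n))
    {d : Fin N → D} (hd : ∀ i, P.map x (g i) = d i) (f : restricted 𝔬 N) :
    P.op hP d f = P.map x (subst g f) :=
  (hP.exists_op d).choose_spec m x g hd f

/-- The evaluation of restricted series in a ring generated by parameters. -/
noncomputable def evaluation (hP : P.IsSurj) : Evaluation 𝔬 D where
  op d := P.op hP d
  op_indet d i := by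
    obtain ⟨m, x, g, hg⟩ := hP.exists_fin d
    rw [P.op_eq hP x g hg, subst_indet, hg]
  op_subst d c f := by
    obtain ⟨m, x, g, hg⟩ := hP.exists_fin d
    rw [P.op_eq hP x g hg, algHom_comp_subst]
    exact (P.op_eq hP x _ (fun i => (P.op_eq hP x g hg (c i)).symm) f).symm

lemma evaluation_op (hP : P.IsSurj) {m N : ℕ} (x : Fin m → R) (g : Fin N → restricted 𝔬 (m + n))
    (f : restricted 𝔬 N) :
    (P.evaluation hP).op (fun i => P.map x (g i)) f = P.map x (subst g f) :=
  P.op_eq hP x g (fun _ => rfl) f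

variable {P} in
-- Two representatives of one element are compared over their concatenated parameters, so
-- containment of kernels suffices for the map to be well defined.
lemma IsSurj.exists_lift (hP : P.IsSurj) {D' : Type*} [CommRing D'] (P' : Presentation 𝔬 R n D')
    (h : ∀ (m : ℕ) (x : Fin m → R) (f : restricted 𝔬 (m + n)), P.map x f = 0 → P'.map x f = 0) :
    ∃ φ : D →+* D', ∀ (m : ℕ) (x : Fin m → R) (f : restricted 𝔬 (m + n)),
      φ (P.map x f) = P'.map x f := by
  have key : ∀ d, ∃ d', ∀ (m : ℕ) (x : Fin m → R) (f : restricted 𝔬 (m + n)),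
      P.map x f = d → d' = P'.map x f := by
    intro d
    obtain ⟨m', x', f', hf'⟩ := hP d
    refine ⟨P'.map x' f', fun m x f hf => ?_⟩
    rw [← P'.map_append_left x' x, ← P'.map_append_right x' x, ← sub_eq_zero, ← map_sub]
    apply h
    rw [map_sub, P.map_append_left, P.map_append_right, hf, hf', sub_self]
  choose φ hφ using key
  have hpair : ∀ d d', ∃ (m : ℕ) (x : Fin m → R) (f f' : restricted 𝔬 (m + n)),
      P.map x f = d ∧ P.map x f' = d' := by
    intro d d'
    obtain ⟨m, x, g, hg⟩ := hP.exists_fin ![d, d']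
    exact ⟨m, x, g 0, g 1, hg 0, hg 1⟩
  refine ⟨⟨⟨⟨φ, ?_⟩, ?_⟩, ?_, ?_⟩, fun m x f => hφ _ m x f rfl⟩
  · rw [hφ 1 0 Fin.elim0 1 (map_one _), map_one]
  · intro d d'
    change φ (d * d') = φ d * φ d'
    obtain ⟨m, x, f, f', rfl, rfl⟩ := hpair d d'
    rw [hφ _ m x (f * f') (map_mul _ _ _), map_mul, ← hφ _ m x f rfl, ← hφ _ m x f' rfl]
  · change φ 0 = 0
    rw [hφ 0 0 Fin.elim0 0 (map_zero _), map_zero]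
  · intro d d'
    change φ (d + d') = φ d + φ d'
    obtain ⟨m, x, f, f', rfl, rfl⟩ := hpair d d'
    rw [hφ _ m x (f + f') (map_add _ _ _), map_add, ← hφ _ m x f rfl, ← hφ _ m x f' rfl]

end Presentation

lemma append_padEmb {α : Type*} {m m' n : ℕ} (e : Fin m ↪ Fin m') (x : Fin m' → α)
    (y : Fin n → α) (i : Fin (m + n)) :
    Fin.append x y (padEmb n e i) = Fin.append (fun i => x (e i)) y i := by
  refine Fin.addCases (fun i => ?_) (fun i => ?_) i <;> simp [padEmb]

/-- Evaluation at a fixed tuple `y`, with parameters taken from `C` along `θ`. -/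
noncomputable def Evaluation.presentation {C D : Type*} [CommRing D] (T : Evaluation 𝔬 D)
    (θ : C → D) {n : ℕ} (y : Fin n → D) : Presentation 𝔬 C n D where
  map x := T.op (Fin.append (fun i => θ (x i)) y)
  map_rename e x f := by
    rw [T.op_renameHom]
    congr 2
    ext i
    rw [append_padEmb]

end Evaluation

/-! ### Nakayama's lemma for rings with evaluation. -/

section FiniteGeneration

lemma mem_smul_top_pi {A M ι : Type*} [CommRing A] [AddCommGroup M] [Module A M] [Finite ι]
    (I : Ideal A) {x : ι → M} (hx : ∀ i, x i ∈ (I • ⊤ : Submodule A M)) :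
    x ∈ (I • ⊤ : Submodule A (ι → M)) := by
  classical
  cases nonempty_fintype ι
  rw [← Finset.univ_sum_single x]
  refine Submodule.sum_mem _ fun i _ => ?_
  have h := Submodule.mem_map_of_mem (f := LinearMap.single A (fun _ : ι => M) i) (hx i)
  rw [Submodule.map_smul''] at h
  exact Submodule.smul_mono le_rfl le_top h

instance isPrecomplete_pi {A M ι : Type*} [CommRing A] [AddCommGroup M] [Module A M] [Finite ι]
    (I : Ideal A) [IsPrecomplete I M] : IsPrecomplete I (ι → M) where
  prec' F hF := by
    have h : ∀ i, ∃ l, ∀ e, F e i ≡ l [SMOD (I ^ e • ⊤ : Submodule A M)] := fun i =>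
      IsPrecomplete.prec (inferInstance : IsPrecomplete I M) fun {a b} hab => by
        have h1 := hF hab
        rw [SModEq.sub_mem] at h1 ⊢
        have h2 := Submodule.mem_map_of_mem (f := LinearMap.proj (R := A) (φ := fun _ : ι => M) i) h1
        rw [Submodule.map_smul''] at h2
        exact Submodule.smul_mono le_rfl le_top h2
    choose l hl using h
    refine ⟨l, fun e => ?_⟩
    rw [SModEq.sub_mem]
    refine mem_smul_top_pi _ fun i => ?_
    have := hl i e
    rwa [SModEq.sub_mem] at this

variable {A : Type*} [CommRing A] [IsNoetherianRing A] {𝔬 : Ideal A} [IsAdicComplete 𝔬 A]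

/-- If `1` and all `Y_l E_j` are combinations of the `E_j` with coefficients in `A⟨X⟩`, modulo an
ideal `J` and `𝔬`, then every element of `A⟨X, Y⟩` is such a combination modulo `J`. -/
lemma exists_combination {m n N : ℕ} (J : Ideal (restricted 𝔬 (m + n)))
    (E : Fin N → restricted 𝔬 (m + n))
    (h1 : ∃ H : Fin N → restricted 𝔬 m,
      1 - ∑ j, renameHom (Fin.castAddEmb n) (H j) * E j ∈ J ⊔ extIdeal 𝔬 (m + n))
    (hY : ∀ l i, ∃ H : Fin N → restricted 𝔬 m,
      indet 𝔬 (Fin.natAdd m l) * E i - ∑ j, renameHom (Fin.castAddEmb n) (H j) * E j ∈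
        J ⊔ extIdeal 𝔬 (m + n)) (f : restricted 𝔬 (m + n)) :
    ∃ H : Fin N → restricted 𝔬 m, f - ∑ j, renameHom (Fin.castAddEmb n) (H j) * E j ∈ J := by
  set ρ := renameHom (𝔬 := 𝔬) (Fin.castAddEmb n (n := m)) with hρ
  set J' := J ⊔ extIdeal 𝔬 (m + n) with hJ'
  -- Good elements form an `A⟨X⟩`-module containing `1` and `J'` and stable under each `Y_l`. Hence
  -- all polynomials are good, and so are all series, being polynomials modulo `𝔬`.
  let Good : restricted 𝔬 (m + n) → Prop := fun g =>
    ∃ H : Fin N → restricted 𝔬 m, g - ∑ j, ρ (H j) * E j ∈ J'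
  have hadd : ∀ g g', Good g → Good g' → Good (g + g') := by
    rintro g g' ⟨H, hH⟩ ⟨H', hH'⟩
    refine ⟨fun j => H j + H' j, ?_⟩
    have := add_mem hH hH'
    simp only [map_add, add_mul, Finset.sum_add_distrib]
    convert this using 1
    ring
  have hmul : ∀ h g, Good g → Good (ρ h * g) := by
    rintro h g ⟨H, hH⟩
    refine ⟨fun j => h * H j, ?_⟩
    have := Ideal.mul_mem_left J' (ρ h) hH
    rw [mul_sub, Finset.mul_sum] at this
    simpa only [map_mul, mul_assoc] using this
  have hmem : ∀ g ∈ J', Good g := fun g hg => ⟨0, by simpa using hg⟩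
  have hsum : ∀ (g : Fin N → restricted 𝔬 (m + n)), (∀ j, Good (g j)) → Good (∑ j, g j) :=
    fun g hg => Finset.sum_induction _ Good hadd (hmem 0 (zero_mem _)) fun j _ => hg j
  have hmulY : ∀ l g, Good g → Good (g * indet 𝔬 (Fin.natAdd m l)) := by
    rintro l g ⟨H, hH⟩
    have h3 : g * indet 𝔬 (Fin.natAdd m l) =
        ∑ j, ρ (H j) * (indet 𝔬 (Fin.natAdd m l) * E j) +
          (g - ∑ j, ρ (H j) * E j) * indet 𝔬 (Fin.natAdd m l) := by
      rw [sub_mul, Finset.sum_mul]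
      have : ∀ j, ρ (H j) * (indet 𝔬 (Fin.natAdd m l) * E j) =
          ρ (H j) * E j * indet 𝔬 (Fin.natAdd m l) := fun j => by ring
      simp only [this]
      ring
    rw [h3]
    exact hadd _ _ (hsum _ fun j => hmul _ _ (hY l j)) (hmem _ (Ideal.mul_mem_right _ _ hH))
  have hpoly : ∀ p : MvPolynomial (Fin (m + n)) A, Good (MvPolynomial.aeval (indet 𝔬) p) := by
    intro p
    induction p using MvPolynomial.induction_on with
    | C a =>
      have := hmul (algebraMap A _ a) 1 h1
      rw [AlgHom.commutes, mul_one] at this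
      rwa [MvPolynomial.aeval_C]
    | add p q hp hq =>
      rw [map_add]
      exact hadd _ _ hp hq
    | mul_X p i hp =>
      rw [map_mul, MvPolynomial.aeval_X]
      refine Fin.addCases (fun i => ?_) (fun i => ?_) i
      · have := hmul (indet 𝔬 i) _ hp
        rw [renameHom_indet, mul_comm] at this
        exact this
      · exact hmulY _ _ hp
  have hall : ∀ g, Good g := by
    intro g
    obtain ⟨p, hp⟩ := exists_polynomial_sub_mem g 1
    rw [pow_one] at hp
    have := hadd _ _ (hpoly p) (hmem _ (Ideal.mem_sup_right hp))
    rwa [add_sub_cancel] at this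
  let Φ : (Fin N → restricted 𝔬 m) →ₗ[A] restricted 𝔬 (m + n) ⧸ J :=
    ∑ j, (Ideal.Quotient.mkₐ A J).toLinearMap ∘ₗ LinearMap.mulRight A (E j) ∘ₗ ρ.toLinearMap ∘ₗ
      LinearMap.proj j
  have hΦ : ∀ H, Φ H = Ideal.Quotient.mk J (∑ j, ρ (H j) * E j) := by
    intro H
    simp [Φ]
  have := isHausdorff_quotient J
  have hsurj : Function.Surjective Φ := by
    -- The source `A⟨X⟩ ^ N` is complete and the target separated, so surjectivity modulo `𝔬`
    -- suffices.
    refine surjective_of_mkQ_comp_surjective (I := 𝔬) fun x => ?_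
    obtain ⟨x, rfl⟩ := Submodule.mkQ_surjective _ x
    obtain ⟨g, rfl⟩ := Ideal.Quotient.mk_surjective x
    obtain ⟨H, hH⟩ := hall g
    refine ⟨H, ?_⟩
    symm
    rw [LinearMap.comp_apply, hΦ, ← sub_eq_zero, ← map_sub, ← map_sub, Submodule.mkQ_apply,
      Submodule.Quotient.mk_eq_zero, Ideal.smul_top_eq_map, Submodule.restrictScalars_mem]
    have h2 := Ideal.mem_map_of_mem (Ideal.Quotient.mk J) hH
    rw [hJ', Ideal.map_sup, Ideal.map_quotient_self, bot_sup_eq, Ideal.map_map] at h2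
    exact h2
  obtain ⟨H, hH⟩ := hsurj (Ideal.Quotient.mk J f)
  refine ⟨H, ?_⟩
  rw [← Ideal.Quotient.eq, ← hΦ, hH]

/-- A form of Nakayama's lemma: if `D` is generated by `y` over `C` as a ring with evaluation, and
is spanned by `e` over `C` modulo `𝔬 D`, then it is spanned by `e`. -/
theorem Evaluation.span_of_span_mod {C D : Type*} [CommRing C] [CommRing D] {T : Evaluation 𝔬 C}
    {T' : Evaluation 𝔬 D} {θ : C →+* D} (hθ : T.IsHom T' θ) {n N : ℕ} {y : Fin n → D}
    (hy : (T'.presentation θ y).IsSurj) (e : Fin N → D)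
    (he : ∀ d, ∃ h : Fin N → C, d - ∑ j, θ (h j) * e j ∈ 𝔬.map T'.struct) (d : D) :
    ∃ h : Fin N → C, d = ∑ j, θ (h j) * e j := by
  obtain ⟨r, a, ha⟩ := Submodule.fg_iff_exists_fin_generating_family.1
    (IsNoetherian.noetherian 𝔬)
  have hmap : ∀ φ : A →+* D, 𝔬.map φ = Ideal.span (Set.range (φ ∘ a)) := fun φ => by
    rw [← ha, Ideal.submodule_span_eq, Ideal.map_span, ← Set.range_comp]
  -- Only these finitely many elements, `1` and the products `y_l e_i`, have to be expressed by the
  -- `e_j` modulo `𝔬 D`; each relation involves finitely many coefficients.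
  let v : Option (Fin n × Fin N) → D := fun k => k.elim 1 fun p => y p.1 * e p.2
  have hw : ∀ k, ∃ (h : Fin N → C) (w : Fin r → D),
      v k = ∑ j, θ (h j) * e j + ∑ i, w i * T'.struct (a i) := by
    intro k
    obtain ⟨h, hh⟩ := he (v k)
    rw [hmap, Ideal.mem_span_range_iff_exists_fun] at hh
    obtain ⟨w, hw⟩ := hh
    exact ⟨h, w, by rw [← sub_eq_iff_eq_add', ← hw]; rfl⟩
  choose h w hw using hw
  -- All data are lifted to one `A⟨X, Y⟩`: `d`, the `e_j` and the error terms `w` as series. The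
  -- coefficients `h` must lift to `A⟨X⟩`, so they are adjoined as parameters and lift to
  -- indeterminates.
  obtain ⟨m, x, g, idx, hg, hidx⟩ := hy.exists_finite_params
    (ι := Option (Fin N ⊕ (Option (Fin n × Fin N) × Fin r)))
    (κ := Option (Fin n × Fin N) × Fin N)
    (fun k => k.elim d (Sum.elim e fun p => w p.1 p.2)) fun p => h p.1 p.2
  set π := (T'.presentation θ y).map x with hπ
  have hπc : ∀ f : restricted 𝔬 m, π (renameHom (Fin.castAddEmb n) f) = θ (T.op x f) := by
    intro f
    rw [hθ]
    refine (T'.op_renameHom _ _ _).trans ?_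
    congr 2
    ext i
    simp
  have hπy : ∀ l, π (indet 𝔬 (Fin.natAdd m l)) = y l := fun l =>
    (T'.op_indet _ _).trans (Fin.append_right _ _ l)
  have hπa : ∀ b, π (algebraMap A _ b) = T'.struct b := fun b => T'.op_algebraMap _ b
  let E : Fin N → restricted 𝔬 (m + n) := fun j => g (some (Sum.inl j))
  have hE : ∀ j, π (E j) = e j := fun j => hg (some (Sum.inl j))
  have hker : ∀ (k : Option (Fin n × Fin N)) (V : restricted 𝔬 (m + n)), π V = v k →
      ∃ H : Fin N → restricted 𝔬 m, V - ∑ j, renameHom (Fin.castAddEmb n) (H j) * E j ∈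
        RingHom.ker π ⊔ extIdeal 𝔬 (m + n) := by
    intro k V hV
    let W := ∑ i, g (some (Sum.inr (k, i))) * algebraMap A _ (a i)
    refine ⟨fun j => indet 𝔬 (idx (k, j)), ?_⟩
    rw [← sub_add_cancel (V - _) W]
    refine add_mem (Ideal.mem_sup_left ?_) (Ideal.mem_sup_right ?_)
    · have hW : π W = ∑ i, w k i * T'.struct (a i) := by
        simp only [W, map_sum, map_mul, hπa]
        exact Finset.sum_congr rfl fun i _ => congrArg (· * _) (hg (some (Sum.inr (k, i))))
      have hS : π (∑ j, renameHom (Fin.castAddEmb n) (indet 𝔬 (idx (k, j))) * E j) =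
          ∑ j, θ (h k j) * e j := by
        simp only [map_sum, map_mul, hπc, hE, T.op_indet, hidx]
      rw [RingHom.mem_ker, map_sub, map_sub, hS, hW, hV, hw k]
      ring
    · refine Ideal.sum_mem _ fun i _ => Ideal.mul_mem_left _ _ (Ideal.mem_map_of_mem _ ?_)
      rw [← ha]
      exact Submodule.subset_span ⟨i, rfl⟩
  obtain ⟨H, hH⟩ := exists_combination (RingHom.ker π) E
    (hker none 1 (map_one _))
    (fun l i => hker (some (l, i)) _ (by rw [map_mul, hπy, hE]; rfl)) (g none)
  refine ⟨fun j => T.op x (H j), ?_⟩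
  rw [RingHom.mem_ker, map_sub, sub_eq_zero] at hH
  have hd : π (g none) = d := hg none
  rw [← hd, hH]
  simp only [map_sum, map_mul, hπc, hE]

end FiniteGeneration

/-! ### `R⟨Y⟩` as a ring with evaluation, and its universal property. -/

section Series

variable {A : Type*} [CommRing A] [IsNoetherianRing A] {𝔬 : Ideal A} [IsAdicComplete 𝔬 A]

/-- The composite of a presentation with a ring morphism. -/
noncomputable def Presentation.comp {R D D' : Type*} {n : ℕ} [CommRing D] [CommRing D']
    (P : Presentation 𝔬 R n D) (q : D →+* D') : Presentation 𝔬 R n D' where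
  map x := q.comp (P.map x)
  map_rename e x f := congrArg q (P.map_rename e x f)

lemma Presentation.IsSurj.comp {R D D' : Type*} {n : ℕ} [CommRing D] [CommRing D']
    {P : Presentation 𝔬 R n D} (hP : P.IsSurj) {q : D →+* D'} (hq : Function.Surjective q) :
    (P.comp q).IsSurj := by
  intro d
  obtain ⟨d, rfl⟩ := hq d
  obtain ⟨m, x, f, rfl⟩ := hP d
  exact ⟨m, x, f, rfl⟩

lemma Presentation.isHom_comp {R D D' : Type*} {n : ℕ} [CommRing D] [CommRing D']
    {P : Presentation 𝔬 R n D} (hP : P.IsSurj) {q : D →+* D'} (hq : Function.Surjective q) :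
    (P.evaluation hP).IsHom ((P.comp q).evaluation (hP.comp hq)) q := by
  intro N b f
  obtain ⟨m, x, g, hg⟩ := hP.exists_fin b
  obtain rfl : (fun i => P.map x (g i)) = b := funext hg
  rw [Presentation.evaluation_op]
  exact ((P.comp q).evaluation_op (hP.comp hq) x g f).symm

namespace AnalyticStructure

variable {R : Type*} [CommRing R] (S : AnalyticStructure 𝔬 R)

lemma specialize_one {m n : ℕ} (x : Fin m → R) :
    S.specialize (1 : restricted 𝔬 (m + n)) x = 1 := by
  classical
  ext ν
  have h := slice_renameHom_castAdd (𝔬 := 𝔬) (1 : restricted 𝔬 m) ν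
  rw [map_one] at h
  rw [coeff_specialize, h, coeff_one]
  split_ifs <;> simp

lemma specialize_zero {m n : ℕ} (x : Fin m → R) :
    S.specialize (0 : restricted 𝔬 (m + n)) x = 0 := by
  ext ν
  rw [coeff_specialize, ← sliceHom_apply, map_zero, map_zero]
  rfl

/-- The morphism `A⟨X, Y⟩ → R⟨Y⟩`, `f ↦ f(x, Y)`. -/
noncomputable def spec {m n : ℕ} (x : Fin m → R) : restricted 𝔬 (m + n) →+* S.series n where
  toFun f := ⟨S.specialize f x, m, f, x, rfl⟩
  map_one' := Subtype.ext (S.specialize_one x)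
  map_mul' f g := Subtype.ext (S.specialize_mul f g x)
  map_zero' := Subtype.ext (S.specialize_zero x)
  map_add' f g := Subtype.ext (S.specialize_add f g x)

lemma coeff_spec {m n : ℕ} (x : Fin m → R) (f : restricted 𝔬 (m + n)) (ν : Fin n →₀ ℕ) :
    coeff ν (S.spec x f).1 = S.iota m (slice f ν) x := rfl

/-- The presentation of `R⟨Y⟩` by the morphisms `f ↦ f(x, Y)`. -/
noncomputable def seriesPresentation (n : ℕ) : Presentation 𝔬 R n (S.series n) where
  map x := S.spec x
  map_rename e x f := Subtype.ext
    (S.specialize_rename e x (fun h => S.evaluation.op_renameHom e x h) f)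

lemma seriesPresentation_isSurj (n : ℕ) : (S.seriesPresentation n).IsSurj := by
  rintro ⟨_, m, f, x, rfl⟩
  exact ⟨m, x, f, rfl⟩

/-- The constants in `R⟨Y⟩`. -/
noncomputable def seriesC (n : ℕ) : R →+* S.series n :=
  (C : R →+* MvPowerSeries (Fin n) R).codRestrict _ (S.C_mem_series n)

noncomputable instance (n : ℕ) : Algebra R (S.series n) := (S.seriesC n).toAlgebra

lemma coe_algebraMap_series (n : ℕ) (a : R) :
    (algebraMap R (S.series n) a : MvPowerSeries (Fin n) R) = C a := rfl

lemma spec_renameHom {m n : ℕ} (x : Fin m → R) (f : restricted 𝔬 m) :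
    S.spec x (renameHom (Fin.castAddEmb n) f) = algebraMap R (S.series n) (S.evalAt x f) := by
  classical
  apply Subtype.ext
  ext ν
  rw [coeff_spec, slice_renameHom_castAdd, coe_algebraMap_series, coeff_C]
  split_ifs
  · rfl
  · simp

lemma coe_spec_monomialY {m n : ℕ} (x : Fin m → R) (ν : Fin n →₀ ℕ) :
    (S.spec x (monomialY 𝔬 m ν) : MvPowerSeries (Fin n) R) = monomial ν 1 := by
  classical
  ext ν'
  rw [coeff_spec, slice_monomialY, coeff_monomial]
  split_ifs <;> simp

/-- The indeterminates of `R⟨Y⟩`. -/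
noncomputable def seriesX {n : ℕ} (l : Fin n) : S.series n :=
  S.spec (Fin.elim0 : Fin 0 → R) (indet 𝔬 (Fin.natAdd 0 l))

lemma monomialY_single {m n : ℕ} (l : Fin n) :
    monomialY 𝔬 m (Finsupp.single l 1) = indet 𝔬 (Fin.natAdd m l) := by
  classical
  rw [monomialY, Finset.prod_eq_single l]
  · simp
  · intro b _ hb
    simp [Finsupp.single_eq_of_ne hb]
  · simp

lemma spec_indet_natAdd {m n : ℕ} (x : Fin m → R) (l : Fin n) :
    S.spec x (indet 𝔬 (Fin.natAdd m l)) = S.seriesX l := by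
  apply Subtype.ext
  rw [seriesX, ← monomialY_single, ← monomialY_single, coe_spec_monomialY, coe_spec_monomialY]

lemma coe_seriesX {n : ℕ} (l : Fin n) : (S.seriesX l : MvPowerSeries (Fin n) R) = X l := by
  rw [seriesX, ← monomialY_single, coe_spec_monomialY]
  rfl

/-- The evaluation of restricted series in `R⟨Y⟩`. -/
noncomputable def seriesEvaluation (n : ℕ) : Evaluation 𝔬 (S.series n) :=
  (S.seriesPresentation n).evaluation (S.seriesPresentation_isSurj n)

lemma seriesEvaluation_op {m n N : ℕ} (x : Fin m → R) (g : Fin N → restricted 𝔬 (m + n))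
    (f : restricted 𝔬 N) :
    (S.seriesEvaluation n).op (fun i => S.spec x (g i)) f = S.spec x (subst g f) :=
  (S.seriesPresentation n).evaluation_op (S.seriesPresentation_isSurj n) x g f

lemma isHom_algebraMap_series (n : ℕ) :
    S.evaluation.IsHom (S.seriesEvaluation n) (algebraMap R (S.series n)) := by
  intro N b f
  have h := S.seriesEvaluation_op (n := n) b (fun i => indet 𝔬 (Fin.castAddEmb n i)) f
  rw [← renameHom_eq_subst, spec_renameHom] at h
  refine h.symm.trans ?_
  congr 2
  ext1 i
  rw [← renameHom_indet, spec_renameHom]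
  exact congrArg _ (S.iota_indet _ _ _)

lemma op_append_seriesX {m n : ℕ} (x : Fin m → R) (f : restricted 𝔬 (m + n)) :
    (S.seriesEvaluation n).op
      (Fin.append (fun i => algebraMap R (S.series n) (x i)) S.seriesX) f = S.spec x f := by
  have h := S.seriesEvaluation_op (n := n) x (fun i => indet 𝔬 i) f
  have hid : subst (fun i => indet 𝔬 i) = AlgHom.id A (restricted 𝔬 (m + n)) :=
    algHom_restricted_ext (by simp)
  rw [hid, AlgHom.id_apply] at h
  rw [← h]
  congr 2
  ext1 i
  refine Fin.addCases (fun i => ?_) (fun i => ?_) i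
  · rw [Fin.append_left]
    have := S.spec_renameHom (n := n) x (indet 𝔬 i)
    rw [renameHom_indet] at this
    exact (this.trans (congrArg _ (S.iota_indet _ _ _))).symm
  · rw [Fin.append_right, spec_indet_natAdd]

lemma isSurj_of_surjective {n : ℕ} {D : Type*} [CommRing D] {T : Evaluation 𝔬 D}
    {q : S.series n →+* D} (hq : Function.Surjective q) (hT : (S.seriesEvaluation n).IsHom T q) :
    (T.presentation (fun a => q (algebraMap R _ a)) fun l => q (S.seriesX l)).IsSurj := by
  intro d
  obtain ⟨g, rfl⟩ := hq d
  obtain ⟨m, x, f, rfl⟩ := S.seriesPresentation_isSurj n g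
  refine ⟨m, x, f, ?_⟩
  change _ = q (S.spec x f)
  rw [← op_append_seriesX, hT]
  refine congrArg (fun z => T.op z f) (funext fun i => ?_)
  refine Fin.addCases (fun i => ?_) (fun i => ?_) i <;> simp

/-- The universal property of `R⟨Y⟩`. -/
theorem exists_series_lift {B : Type*} [CommRing B] {T : Evaluation 𝔬 B} {θ : R →+* B}
    (hθ : S.evaluation.IsHom T θ) {n : ℕ} (b : Fin n → B) : ∃ Θ : S.series n →+* B,
      (∀ (m : ℕ) (x : Fin m → R) (f : restricted 𝔬 (m + n)),
        Θ (S.spec x f) = T.op (Fin.append (fun i => θ (x i)) b) f) ∧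
      (S.seriesEvaluation n).IsHom T Θ ∧
      (∀ a, Θ (algebraMap R (S.series n) a) = θ a) ∧ ∀ l, Θ (S.seriesX l) = b l := by
  obtain ⟨Θ, hΘ⟩ := (S.seriesPresentation_isSurj n).exists_lift (T.presentation θ b) (by
    intro m x f hf
    -- Vanishing of `f(x, Y)` means that all `f_ν(x)` vanish. As `f` lies in the ideal generated by
    -- the `f_ν(X)`, it is killed by evaluation at `(θ x, b)`.
    have h0 : ∀ ν, S.evalAt x (slice f ν) = 0 := fun ν => by
      have := congrArg (fun g : S.series n => coeff ν g.1) hf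
      exact this
    have hle : Ideal.span (Set.range fun ν => renameHom (Fin.castAddEmb n) (slice f ν)) ≤
        RingHom.ker (T.op (Fin.append (fun i => θ (x i)) b)) := by
      rw [Ideal.span_le]
      rintro _ ⟨ν, rfl⟩
      change T.op _ _ = 0
      rw [T.op_renameHom]
      have : (fun i => Fin.append (fun i => θ (x i)) b (Fin.castAddEmb n i)) =
          fun i => θ (x i) := funext fun i => Fin.append_left _ _ i
      rw [this, ← hθ]
      exact (congrArg θ (h0 ν)).trans (map_zero θ)
    exact hle (mem_span_slice f))
  have hΘ' : ∀ (m : ℕ) (x : Fin m → R) (f : restricted 𝔬 (m + n)),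
      Θ (S.spec x f) = T.op (Fin.append (fun i => θ (x i)) b) f := hΘ
  refine ⟨Θ, hΘ', ?_, fun a => ?_, fun l => ?_⟩
  · intro N c f
    obtain ⟨m, x, g, hg⟩ := (S.seriesPresentation_isSurj n).exists_fin c
    obtain rfl : (fun i => S.spec x (g i)) = c := funext hg
    rw [seriesEvaluation_op, hΘ', T.op_subst]
    simp only [hΘ']
  -- The constant `a` is the indeterminate `X₁` specialized at the parameter `a`.
  · have h := hΘ' 1 (fun _ => a) (renameHom (Fin.castAddEmb n) (indet 𝔬 0))
    rw [spec_renameHom] at h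
    rw [renameHom_indet, T.op_indet] at h
    refine (congrArg (fun z => Θ (algebraMap R _ z)) (S.iota_indet 1 0 fun _ => a)).symm.trans
      (h.trans ?_)
    exact Fin.append_left _ _ _
  · have h := hΘ' 0 Fin.elim0 (indet 𝔬 (Fin.natAdd 0 l))
    rw [T.op_indet, Fin.append_right] at h
    exact h

end AnalyticStructure

end Series

/-! ### Reduction of `R⟨Y⟩` to polynomials over the residue field. -/

namespace AnalyticStructure

section Reduction

variable {A : Type*} [CommRing A] [IsNoetherianRing A] {𝔬 : Ideal A} [IsAdicComplete 𝔬 A]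
  {R : Type*} [CommRing R] (S : AnalyticStructure 𝔬 R) {n : ℕ}

lemma coeff_mem_of_mem_map_series {J : Ideal R} {g : S.series n}
    (hg : g ∈ J.map (algebraMap R (S.series n))) (ν : Fin n →₀ ℕ) : coeff ν g.1 ∈ J := by
  classical
  induction hg using Submodule.span_induction generalizing ν with
  | mem x hx =>
    obtain ⟨a, ha, rfl⟩ := hx
    rw [coe_algebraMap_series, coeff_C]
    split_ifs
    exacts [ha, zero_mem _]
  | zero => simp
  | add x y _ _ hx hy => simpa using add_mem (hx ν) (hy ν)
  | smul a x _ hx =>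
    rw [smul_eq_mul, Subring.coe_mul, coeff_mul]
    exact Ideal.sum_mem _ fun p _ => Ideal.mul_mem_left _ _ (hx p.2)

lemma coe_aeval_seriesX (p : MvPolynomial (Fin n) R) :
    (MvPolynomial.aeval (S.seriesX (n := n)) p : MvPowerSeries (Fin n) R) = p := by
  have : (S.series n).subtype.comp
      (MvPolynomial.aeval (S.seriesX (n := n)) : _ →ₐ[R] S.series n).toRingHom =
      MvPolynomial.coeToMvPowerSeries.ringHom := by
    apply MvPolynomial.ringHom_ext
    · intro a
      simp [coe_algebraMap_series]
    · intro i
      simp [coe_seriesX]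
  exact congrArg (fun φ => φ p) this

lemma map_seriesEvaluation_struct :
    𝔬.map (S.seriesEvaluation n).struct =
      (𝔬.map S.structMap).map (algebraMap R (S.series n)) := by
  rw [Ideal.map_map]
  congr 1
  ext a : 1
  exact (Evaluation.IsHom.struct (S.isHom_algebraMap_series n) a).symm

/-- Pushes the finite expansion of `f(X, Y)` modulo `𝔬` down from `A⟨X, Y⟩` by specializing `X` to
`x`. -/
lemma exists_polynomial_sub_mem_series (g : S.series n) : ∃ p : MvPolynomial (Fin n) R,
    g - MvPolynomial.aeval S.seriesX p ∈ (𝔬.map S.structMap).map (algebraMap R (S.series n)) := by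
  obtain ⟨m, x, f, rfl⟩ := S.seriesPresentation_isSurj n g
  change ∃ p : MvPolynomial (Fin n) R, S.spec x f - MvPolynomial.aeval S.seriesX p ∈ _
  obtain ⟨s, hs⟩ := exists_sub_sum_slice_mem f 1
  rw [pow_one] at hs
  have h := (S.seriesEvaluation n).op_mem_map_struct
    (Fin.append (fun i => algebraMap R (S.series n) (x i)) S.seriesX) hs
  rw [op_append_seriesX, map_seriesEvaluation_struct, map_sub, map_sum] at h
  refine ⟨∑ ν ∈ s, MvPolynomial.monomial ν (S.evalAt x (slice f ν)), ?_⟩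
  convert h using 2
  rw [map_sum]
  refine Finset.sum_congr rfl fun ν _ => ?_
  rw [map_mul, spec_renameHom, MvPolynomial.aeval_monomial, Finsupp.prod_fintype _ _ (by simp),
    monomialY, map_prod]
  simp only [map_pow, spec_indet_natAdd]

end Reduction

section Viable

variable {A : Type*} [CommRing A] [IsNoetherianRing A] {𝔬 : Ideal A} [IsAdicComplete 𝔬 A]
  {R : Type*} [CommRing R] [IsLocalRing R] {S : AnalyticStructure 𝔬 R} (hS : S.IsViable)
  {n : ℕ}

open IsLocalRing

include hS in
lemma IsViable.exists_coe_eq_map (g : S.series n) : ∃ p : MvPolynomial (Fin n) (ResidueField R),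
    (p : MvPowerSeries (Fin n) (ResidueField R)) = MvPowerSeries.map (residue R) g.1 := by
  obtain ⟨p, hp⟩ := S.exists_polynomial_sub_mem_series g
  refine ⟨MvPolynomial.map (residue R) p, ?_⟩
  ext ν
  rw [hS.1] at hp
  have h := S.coeff_mem_of_mem_map_series hp ν
  rw [AddSubgroupClass.coe_sub, map_sub, coe_aeval_seriesX, MvPolynomial.coeff_coe,
    ← residue_eq_zero_iff, map_sub, sub_eq_zero] at h
  rw [MvPolynomial.coeff_coe, MvPolynomial.coeff_map, coeff_map, h]

/-- Reduction modulo the maximal ideal of `R`, from `R⟨Y⟩` to polynomials over the residue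
field. -/
noncomputable def red : S.series n →+* MvPolynomial (Fin n) (ResidueField R) where
  toFun g := (hS.exists_coe_eq_map g).choose
  map_one' := by
    apply MvPolynomial.coe_injective
    rw [(hS.exists_coe_eq_map 1).choose_spec]
    simp
  map_mul' f g := by
    apply MvPolynomial.coe_injective
    rw [(hS.exists_coe_eq_map _).choose_spec, MvPolynomial.coe_mul,
      (hS.exists_coe_eq_map _).choose_spec, (hS.exists_coe_eq_map _).choose_spec]
    simp
  map_zero' := by
    apply MvPolynomial.coe_injective
    rw [(hS.exists_coe_eq_map 0).choose_spec]
    simp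
  map_add' f g := by
    apply MvPolynomial.coe_injective
    rw [(hS.exists_coe_eq_map _).choose_spec, MvPolynomial.coe_add,
      (hS.exists_coe_eq_map _).choose_spec, (hS.exists_coe_eq_map _).choose_spec]
    simp

lemma coe_red (g : S.series n) :
    (red hS g : MvPowerSeries (Fin n) (ResidueField R)) = MvPowerSeries.map (residue R) g.1 :=
  (hS.exists_coe_eq_map g).choose_spec

lemma coeff_red (g : S.series n) (ν : Fin n →₀ ℕ) :
    MvPolynomial.coeff ν (red hS g) = residue R (coeff ν g.1) := by
  rw [← MvPolynomial.coeff_coe, coe_red, coeff_map]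

lemma red_aeval (p : MvPolynomial (Fin n) R) :
    red hS (MvPolynomial.aeval S.seriesX p) = MvPolynomial.map (residue R) p := by
  ext ν
  rw [coeff_red, coe_aeval_seriesX, MvPolynomial.coeff_coe, MvPolynomial.coeff_map]

lemma red_algebraMap (a : R) :
    red hS (algebraMap R (S.series n) a) = MvPolynomial.C (residue R a) := by
  have := red_aeval hS (n := n) (MvPolynomial.C a)
  simpa using this

lemma red_seriesX (l : Fin n) : red hS (S.seriesX l) = MvPolynomial.X l := by
  have := red_aeval hS (n := n) (MvPolynomial.X l)
  simpa using this

lemma red_surjective : Function.Surjective (red hS (n := n)) := by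
  intro p
  obtain ⟨p, rfl⟩ := MvPolynomial.map_surjective _ (residue_surjective (R := R)) p
  exact ⟨_, red_aeval hS p⟩

/-- An element of the kernel is a polynomial modulo `𝔪 R⟨Y⟩`, and the coefficients of that
polynomial then lie in `𝔪`. With `𝔬 R = 𝔪`, this lets Nakayama lift statements from the residue
field. -/
lemma ker_red : RingHom.ker (red hS (n := n)) =
    (maximalIdeal R).map (algebraMap R (S.series n)) := by
  apply le_antisymm
  · intro g hg
    obtain ⟨p, hp⟩ := S.exists_polynomial_sub_mem_series g
    rw [hS.1] at hp
    have hp' : p ∈ (maximalIdeal R).map MvPolynomial.C := by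
      rw [MvPolynomial.mem_map_C_iff]
      intro ν
      have h := S.coeff_mem_of_mem_map_series hp ν
      rw [AddSubgroupClass.coe_sub, map_sub, coe_aeval_seriesX, MvPolynomial.coeff_coe] at h
      have h2 : coeff ν g.1 ∈ maximalIdeal R := by
        rw [← residue_eq_zero_iff, ← coeff_red hS, RingHom.mem_ker.1 hg, MvPolynomial.coeff_zero]
      simpa using sub_mem h2 h
    have h3 := Ideal.mem_map_of_mem (MvPolynomial.aeval S.seriesX : _ →ₐ[R] S.series n).toRingHom hp'
    have hc : (MvPolynomial.aeval S.seriesX : _ →ₐ[R] S.series n).toRingHom.comp MvPolynomial.C =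
        algebraMap R (S.series n) := by
      ext a : 1
      simp
    rw [Ideal.map_map, hc] at h3
    have := add_mem hp h3
    rwa [show (MvPolynomial.aeval S.seriesX : _ →ₐ[R] S.series n).toRingHom p =
      MvPolynomial.aeval S.seriesX p from rfl, sub_add_cancel] at this
  · rw [Ideal.map_le_iff_le_comap]
    intro a ha
    rw [Ideal.mem_comap, RingHom.mem_ker, red_algebraMap, (residue_eq_zero_iff a).2 ha, map_zero]

lemma map_struct_eq_ker_red :
    𝔬.map (S.seriesEvaluation n).struct = RingHom.ker (red hS (n := n)) := by
  rw [map_seriesEvaluation_struct, hS.1, ker_red]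

end Viable

/-! ### Extraction of constants, and a dimension argument for polynomial rings. -/

section Scaling

variable {A : Type*} [CommRing A] [IsNoetherianRing A] {𝔬 : Ideal A} [IsAdicComplete 𝔬 A]
  {R : Type*} [CommRing R] [IsDomain R] [ValuationRing R] {S : AnalyticStructure 𝔬 R}
  (hS : S.IsViable) {n : ℕ}

lemma exists_dvd_of_finset {ι : Type*} (s : Finset ι) (hs : s.Nonempty) (v : ι → R) :
    ∃ i ∈ s, ∀ j ∈ s, v i ∣ v j := by
  classical
  induction hs using Finset.Nonempty.cons_induction with
  | singleton a => exact ⟨a, by simp, by simp⟩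
  | cons a s ha hs ih =>
    obtain ⟨i, hi, h⟩ := ih
    rcases ValuationRing.dvd_total (v i) (v a) with h1 | h1
    · refine ⟨i, Finset.mem_cons_of_mem hi, fun j hj => ?_⟩
      rcases Finset.mem_cons.1 hj with rfl | hj
      exacts [h1, h j hj]
    · refine ⟨a, Finset.mem_cons_self _ _, fun j hj => ?_⟩
      rcases Finset.mem_cons.1 hj with rfl | hj
      exacts [dvd_rfl, h1.trans (h j hj)]

/-- A nonzero element of `R⟨Y⟩` is a constant times an element with nonzero reduction. -/
theorem exists_eq_mul_red_ne_zero {g : S.series n} (hg : g ≠ 0) :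
    ∃ (c : R) (g' : S.series n), c ≠ 0 ∧ g = algebraMap R (S.series n) c * g' ∧
      red hS g' ≠ 0 := by
  classical
  obtain ⟨m, x, f, rfl⟩ := S.seriesPresentation_isSurj n g
  change S.spec x f ≠ 0 at hg
  change ∃ (c : R) (g' : S.series n), c ≠ 0 ∧ S.spec x f = _ ∧ _
  -- Finitely many coefficients `f_ν(x)` generate `f(x, Y)`; one of them divides the others and can
  -- be factored out.
  obtain ⟨u, hu⟩ := Finsupp.mem_ideal_span_range_iff_exists_finsupp.1 (mem_span_slice f)
  let v : (Fin n →₀ ℕ) → R := fun ν => S.evalAt x (slice f ν)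
  have hsum : S.spec x f = ∑ ν ∈ u.support, S.spec x (u ν) * algebraMap R (S.series n) (v ν) := by
    conv_lhs => rw [← hu]
    rw [Finsupp.sum, map_sum]
    simp only [map_mul, spec_renameHom]
    rfl
  have hne : u.support.Nonempty := by
    by_contra h
    rw [Finset.not_nonempty_iff_eq_empty] at h
    rw [h, Finset.sum_empty] at hsum
    exact hg hsum
  obtain ⟨i, hi, hdvd⟩ := exists_dvd_of_finset u.support hne v
  have hw : ∀ ν, ∃ w, ν ∈ u.support → v ν = v i * w := fun ν => by
    by_cases h : ν ∈ u.support
    · obtain ⟨w, hw⟩ := hdvd ν h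
      exact ⟨w, fun _ => hw⟩
    · exact ⟨0, fun h' => absurd h' h⟩
  choose w hw using hw
  have heq : S.spec x f = algebraMap R (S.series n) (v i) *
      ∑ ν ∈ u.support, S.spec x (u ν) * algebraMap R (S.series n) (w ν) := by
    rw [hsum, Finset.mul_sum]
    refine Finset.sum_congr rfl fun ν hν => ?_
    rw [hw ν hν, map_mul]
    ring
  have hvi : v i ≠ 0 := by
    intro h
    rw [h, map_zero, zero_mul] at heq
    exact hg heq
  refine ⟨v i, _, hvi, heq, fun h => ?_⟩
  -- The constant taken out is the coefficient at `i` itself, so the remaining factor has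
  -- coefficient `1` there.
  have h1 := congrArg (fun g : S.series n => coeff i g.1) heq
  change v i = _ at h1
  simp only [Subring.coe_mul, coe_algebraMap_series, coeff_C_mul] at h1
  have h2 := mul_left_cancel₀ hvi ((mul_one _).trans h1)
  have h3 := coeff_red hS (∑ ν ∈ u.support, S.spec x (u ν) * algebraMap R (S.series n) (w ν)) i
  rw [h, MvPolynomial.coeff_zero, ← h2, map_one] at h3
  exact zero_ne_one h3

end Scaling

end AnalyticStructure

/-- An affine algebra on `n` generators which contains a polynomial ring in `n` variables over
which it is integral is itself a polynomial ring. -/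
lemma injective_of_injective_of_isIntegral {k Q : Type*} [Field k] [CommRing Q] [Algebra k Q]
    {n : ℕ} (γ π : MvPolynomial (Fin n) k →ₐ[k] Q) (hγ : Function.Injective γ)
    (hint : γ.toRingHom.IsIntegral) (hπ : Function.Surjective π) : Function.Injective π := by
  let _ := γ.toRingHom.toAlgebra
  have : Algebra.IsIntegral (MvPolynomial (Fin n) k) Q := ⟨hint⟩
  -- A prime over zero passes to a domain in which the images of the variables under `γ` stay
  -- independent, so its transcendence degree is at least `n`.
  obtain ⟨P, -, hP, hP'⟩ := Ideal.exists_ideal_over_prime_of_isIntegral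
    (⊥ : Ideal (MvPolynomial (Fin n) k)) (⊥ : Ideal Q)
    (le_of_eq ((RingHom.injective_iff_ker_eq_bot _).1 hγ))
  let q : Q →ₐ[k] Q ⧸ P := Ideal.Quotient.mkₐ k P
  have hind : AlgebraicIndependent k fun i => q (γ (MvPolynomial.X i)) := by
    have hcomp : MvPolynomial.aeval (fun i => q (γ (MvPolynomial.X i))) = q.comp γ := by
      ext i
      simp
    change Function.Injective _
    rw [hcomp, injective_iff_map_eq_zero]
    intro f hf
    have hf' : γ f ∈ P := Ideal.Quotient.eq_zero_iff_mem.1 hf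
    have : f ∈ P.comap (algebraMap (MvPolynomial (Fin n) k) Q) := hf'
    rwa [hP', Ideal.mem_bot] at this
  have hcomp : MvPolynomial.aeval (fun i => q (π (MvPolynomial.X i))) = q.comp π := by
    ext i
    simp
  have hadj : Algebra.adjoin k (Set.range fun i => q (π (MvPolynomial.X i))) = ⊤ := by
    rw [Algebra.adjoin_range_eq_range_aeval, hcomp, AlgHom.range_eq_top]
    exact (Ideal.Quotient.mkₐ_surjective k P).comp hπ
  have : Algebra.IsAlgebraic
      (Algebra.adjoin k (Set.range fun i => q (π (MvPolynomial.X i)))) (Q ⧸ P) := by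
    rw [hadj]
    exact ⟨fun x => isAlgebraic_algebraMap (⟨x, trivial⟩ : (⊤ : Subalgebra k (Q ⧸ P)))⟩
  -- The domain is generated by `n` elements and has transcendence degree at least `n`, so these
  -- generators are algebraically independent.
  have hb := Algebra.IsAlgebraic.isTranscendenceBasis_of_lift_le_trdeg_of_finite k
    (fun i => q (π (MvPolynomial.X i))) hind.lift_cardinalMk_le_trdeg
  have hinj : Function.Injective (q.comp π) := by
    rw [← hcomp]
    exact hb.1
  exact Function.Injective.of_comp (f := q) hinj

/-! ### `K⟨Y⟩` as the localization of `R⟨Y⟩` at the nonzero constants. -/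

namespace AnalyticStructure

section Fractions

variable {A : Type*} [CommRing A] {𝔬 : Ideal A} [IsNoetherianRing A] [IsAdicComplete 𝔬 A]
  {R : Type*} [CommRing R] [IsDomain R] (S : AnalyticStructure 𝔬 R)
  (K : Type*) [Field K] [Algebra R K] [IsFractionRing R K] (n : ℕ)

/-- The inclusion of `R⟨Y⟩` in `K⟨Y⟩`. -/
noncomputable def toFrac : S.series n →+* S.fracSeries K n :=
  ((MvPowerSeries.map (algebraMap R K)).comp (S.series n).subtype).codRestrict _
    fun g => ⟨1, one_ne_zero, g.1, g.2, by simp⟩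

variable {K n}

lemma coe_toFrac (g : S.series n) :
    (S.toFrac K n g : MvPowerSeries (Fin n) K) = MvPowerSeries.map (algebraMap R K) g.1 := rfl

lemma toFrac_injective : Function.Injective (S.toFrac K n) := by
  intro g g' h
  apply Subtype.ext
  ext ν
  have h1 := congrArg (fun f : S.fracSeries K n => coeff ν f.1) h
  exact IsFractionRing.injective R K (by simpa [coe_toFrac] using h1)

lemma toFrac_algebraMap (a : R) : S.toFrac K n (algebraMap R (S.series n) a) =
    algebraMap K (S.fracSeries K n) (algebraMap R K a) := by
  apply Subtype.ext
  rw [coe_toFrac, coe_algebraMap_series, map_C]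
  rfl

lemma exists_eq_smul_toFrac (f : S.fracSeries K n) : ∃ (c : R) (g : S.series n), c ≠ 0 ∧
    f = (algebraMap R K c)⁻¹ • S.toFrac K n g := by
  obtain ⟨f, c, hc, g, hg, rfl⟩ := f
  exact ⟨c, ⟨g, hg⟩, hc, rfl⟩

variable (K n) in
lemma isLocalization_toFrac :
    letI := (S.toFrac K n).toAlgebra
    IsLocalization ((nonZeroDivisors R).map (algebraMap R (S.series n))) (S.fracSeries K n) := by
  let _ := (S.toFrac K n).toAlgebra
  have hunit : ∀ c : R, c ≠ 0 → algebraMap R K c ≠ 0 := fun c hc => by simpa using hc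
  refine ⟨?_, ?_, ?_⟩
  · rintro ⟨_, c, hc, rfl⟩
    change IsUnit (S.toFrac K n (algebraMap R (S.series n) c))
    rw [toFrac_algebraMap]
    exact (IsUnit.mk0 _ (hunit c (nonZeroDivisors.ne_zero hc))).map _
  · intro f
    obtain ⟨c, g, hc, rfl⟩ := S.exists_eq_smul_toFrac f
    refine ⟨⟨g, algebraMap R _ c, c, mem_nonZeroDivisors_of_ne_zero hc, rfl⟩, ?_⟩
    change _ * S.toFrac K n (algebraMap R (S.series n) c) = S.toFrac K n g
    rw [toFrac_algebraMap, mul_comm, ← Algebra.smul_def, smul_smul, mul_inv_cancel₀ (hunit c hc),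
      one_smul]
  · intro g g' h
    exact ⟨1, by rw [S.toFrac_injective h]⟩

lemma exists_fracSeries_lift {Q : Type*} [CommRing Q] [Algebra K Q] (ψ : S.series n →+* Q)
    (hψ : ∀ a, ψ (algebraMap R (S.series n) a) = algebraMap K Q (algebraMap R K a)) :
    ∃ φ : S.fracSeries K n →ₐ[K] Q, ∀ g, φ (S.toFrac K n g) = ψ g := by
  let _ := (S.toFrac K n).toAlgebra
  have := S.isLocalization_toFrac K n
  let φ : S.fracSeries K n →+* Q := IsLocalization.lift
    (M := (nonZeroDivisors R).map (algebraMap R (S.series n))) (g := ψ) (by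
      rintro ⟨_, c, hc, rfl⟩
      rw [hψ]
      exact (IsUnit.mk0 _ (by simpa using nonZeroDivisors.ne_zero hc)).map _)
  have hφ : ∀ g, φ (S.toFrac K n g) = ψ g := fun g => IsLocalization.lift_eq _ g
  refine ⟨{ φ with commutes' := fun z => ?_ }, hφ⟩
  obtain ⟨a, b, hb, rfl⟩ := IsFractionRing.div_surjective (A := R) z
  change φ (algebraMap K _ _) = _
  have hb' : algebraMap R K b ≠ 0 := by simpa using nonZeroDivisors.ne_zero hb
  have hu : IsUnit (algebraMap K Q (algebraMap R K b)) := (IsUnit.mk0 _ hb').map _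
  rw [← hu.mul_left_inj, ← map_mul, div_mul_cancel₀ _ hb', ← hψ b, ← hφ, toFrac_algebraMap,
    ← map_mul, ← map_mul, div_mul_cancel₀ _ hb', ← toFrac_algebraMap, hφ, hψ]

end Fractions

end AnalyticStructure

/-! ### Quotients of `R⟨Y⟩` and Noether normalization over `R`. -/

namespace AnalyticStructure

section Quotients

variable {A : Type*} [CommRing A] [IsNoetherianRing A] {𝔬 : Ideal A} [IsAdicComplete 𝔬 A]
  {R : Type*} [CommRing R] (S : AnalyticStructure 𝔬 R) {n : ℕ}

/-- The evaluation of restricted series in a quotient of `R⟨Y⟩`. -/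
noncomputable def quotientEvaluation {D : Type*} [CommRing D] {q : S.series n →+* D}
    (hq : Function.Surjective q) : Evaluation 𝔬 D :=
  ((S.seriesPresentation n).comp q).evaluation ((S.seriesPresentation_isSurj n).comp hq)

lemma isHom_quotientEvaluation {D : Type*} [CommRing D] {q : S.series n →+* D}
    (hq : Function.Surjective q) : (S.seriesEvaluation n).IsHom (S.quotientEvaluation hq) q :=
  Presentation.isHom_comp (S.seriesPresentation_isSurj n) hq

lemma isHom_comp_algebraMap {D : Type*} [CommRing D] {q : S.series n →+* D}
    (hq : Function.Surjective q) :
    S.evaluation.IsHom (S.quotientEvaluation hq) (q.comp (algebraMap R (S.series n))) := by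
  intro N b f
  rw [RingHom.comp_apply, S.isHom_algebraMap_series, S.isHom_quotientEvaluation hq]
  rfl

lemma map_quotientEvaluation_struct {D : Type*} [CommRing D] {q : S.series n →+* D}
    (hq : Function.Surjective q) : 𝔬.map (S.quotientEvaluation hq).struct =
      (𝔬.map (S.seriesEvaluation n).struct).map q := by
  rw [Ideal.map_map]
  congr 1
  ext a : 1
  exact (Evaluation.IsHom.struct (S.isHom_quotientEvaluation hq) a).symm

lemma isSurj_quotientEvaluation {D : Type*} [CommRing D] {q : S.series n →+* D}
    (hq : Function.Surjective q) {C : Type*} [CommRing C] (θ : C →+* D) (α : R → C)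
    (hθ : ∀ a, θ (α a) = q (algebraMap R _ a)) :
    ((S.quotientEvaluation hq).presentation θ fun l => q (S.seriesX l)).IsSurj := by
  intro d
  obtain ⟨m, x, f, rfl⟩ := S.isSurj_of_surjective hq (S.isHom_quotientEvaluation hq) d
  refine ⟨m, fun i => α (x i), f, ?_⟩
  change (S.quotientEvaluation hq).op _ f = (S.quotientEvaluation hq).op _ f
  simp only [hθ]

/-- A quotient of `R⟨Y⟩` in which the indeterminates are integral over `R` is generated by them
as an algebra. -/
theorem exists_aeval_of_isIntegral {D : Type*} [CommRing D] {q : S.series n →+* D}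
    (hq : Function.Surjective q)
    (hint : ∀ l, (q.comp (algebraMap R (S.series n))).IsIntegralElem (q (S.seriesX l))) (d : D) :
    ∃ p : MvPolynomial (Fin n) R, q (MvPolynomial.aeval S.seriesX p) = d := by
  let _ := (q.comp (algebraMap R (S.series n))).toAlgebra
  have hqp : ∀ p : MvPolynomial (Fin n) R, q (MvPolynomial.aeval S.seriesX p) =
      MvPolynomial.aeval (fun l => q (S.seriesX l)) p := by
    intro p
    let q' : S.series n →ₐ[R] D := { q with commutes' := fun _ => rfl }
    change (q'.comp (MvPolynomial.aeval S.seriesX)) p = _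
    congr 1
    ext l
    simp [q']
  have hrange : ∀ d : D, d ∈ Algebra.adjoin R (Set.range fun l => q (S.seriesX l)) →
      ∃ p : MvPolynomial (Fin n) R, q (MvPolynomial.aeval S.seriesX p) = d := by
    intro d hd
    rw [Algebra.adjoin_range_eq_range_aeval] at hd
    obtain ⟨p, hp⟩ := hd
    exact ⟨p, (hqp p).trans hp⟩
  have hfg := fg_adjoin_of_finite (R := R) (Set.finite_range fun l => q (S.seriesX l))
    (by rintro _ ⟨l, rfl⟩; exact hint l)
  obtain ⟨N, e, he⟩ := Submodule.fg_iff_exists_fin_generating_family.1 hfg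
  -- Integrality makes the image of `R[Y]` a finite `R`-module, and this image is all of `D` modulo
  -- `𝔬 D`; Nakayama over `R` then applies.
  have hspan : ∀ d : D, ∃ h : Fin N → R, d - ∑ j, q (algebraMap R _ (h j)) * e j ∈
      𝔬.map (S.quotientEvaluation hq).struct := by
    intro d
    obtain ⟨g, rfl⟩ := hq d
    obtain ⟨p, hp⟩ := S.exists_polynomial_sub_mem_series g
    have hp' : q (MvPolynomial.aeval S.seriesX p) ∈ Submodule.span R (Set.range e) := by
      rw [he, Subalgebra.mem_toSubmodule, Algebra.adjoin_range_eq_range_aeval]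
      exact ⟨p, (hqp p).symm⟩
    obtain ⟨h, hh⟩ := Submodule.mem_span_range_iff_exists_fun R |>.1 hp'
    refine ⟨h, ?_⟩
    simp only [Algebra.smul_def] at hh
    rw [map_quotientEvaluation_struct, map_seriesEvaluation_struct]
    have := Ideal.mem_map_of_mem q hp
    rwa [map_sub, ← hh] at this
  obtain ⟨h, hd⟩ := Evaluation.span_of_span_mod (S.isHom_comp_algebraMap hq)
    (S.isSurj_quotientEvaluation hq _ id fun _ => rfl) e hspan d
  apply hrange
  rw [hd]
  refine Subalgebra.sum_mem _ fun j _ => Subalgebra.mul_mem _ (Subalgebra.algebraMap_mem _ (h j)) ?_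
  rw [← Subalgebra.mem_toSubmodule, ← he]
  exact Submodule.subset_span ⟨j, rfl⟩

end Quotients

section Finiteness

variable {A : Type*} [CommRing A] [IsNoetherianRing A] {𝔬 : Ideal A} [IsAdicComplete 𝔬 A]
  {R : Type*} [CommRing R] [IsDomain R] [ValuationRing R] {S : AnalyticStructure 𝔬 R}
  (hS : S.IsViable) {n : ℕ}

open IsLocalRing

include hS

/-- Noether normalization over `R`. -/
theorem exists_finite_injective (I : Ideal (S.series n)) (hI : I ≠ ⊤)
    (hsat : ∀ (c : R) (g : S.series n), c ≠ 0 → algebraMap R _ c * g ∈ I → g ∈ I) :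
    ∃ s ≤ n, (I ≠ ⊥ → s < n) ∧ ∃ Θ : S.series s →+* S.series n ⧸ I,
      (∀ a, Θ (algebraMap R _ a) = Ideal.Quotient.mk I (algebraMap R _ a)) ∧
      Function.Injective Θ ∧ ∃ (N : ℕ) (e : Fin N → S.series n ⧸ I),
        ∀ d, ∃ h : Fin N → S.series s, d = ∑ j, Θ (h j) * e j := by
  set q := Ideal.Quotient.mk I with hq_def
  have hq : Function.Surjective q := Ideal.Quotient.mk_surjective
  set J := I.map (red hS (n := n)) with hJ
  have hmem : ∀ g, red hS g ∈ J → q g ∈ 𝔬.map (S.quotientEvaluation hq).struct := by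
    intro g hg
    obtain ⟨g', hg', h⟩ := (Ideal.mem_map_iff_of_surjective _ (red_surjective hS)).1 hg
    have h2 : g - g' ∈ RingHom.ker (red hS (n := n)) := by
      rw [RingHom.mem_ker, map_sub, h, sub_self]
    rw [← map_struct_eq_ker_red] at h2
    have h3 := Ideal.mem_map_of_mem q h2
    rwa [map_sub, Ideal.Quotient.eq_zero_iff_mem.2 hg', sub_zero,
      ← map_quotientEvaluation_struct S hq] at h3
  -- If `J` were the unit ideal, then `D = 𝔬 D` for `D = R⟨Y⟩/I`, and Nakayama with an empty family
  -- would give `D = 0`.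
  have hJtop : J ≠ ⊤ := by
    intro htop
    obtain ⟨h, hh⟩ := Evaluation.span_of_span_mod (S.isHom_comp_algebraMap hq)
      (S.isSurj_quotientEvaluation hq _ id fun _ => rfl) (Fin.elim0 : Fin 0 → S.series n ⧸ I)
      (fun d => ⟨Fin.elim0, by
        obtain ⟨g, rfl⟩ := hq d
        simpa using hmem g (htop ▸ Submodule.mem_top)⟩) 1
    rw [Fin.sum_univ_zero, ← map_one q, Ideal.Quotient.eq_zero_iff_mem] at hh
    exact hI ((Ideal.eq_top_iff_one I).2 hh)
  obtain ⟨s, hs, γ, hγ, hint⟩ := exists_integral_inj_algHom_of_quotient J hJtop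
  refine ⟨s, hs, fun hne => lt_of_le_of_ne hs ?_, ?_⟩
  -- If `s = n`, the dimension argument forces `J = 0`. A nonzero element of `I`, divided by a
  -- constant, stays in `I` by saturation and has nonzero reduction.
  · rintro rfl
    obtain ⟨g, hg, hg0⟩ := Submodule.exists_mem_ne_zero_of_ne_bot hne
    obtain ⟨c, g', hc, rfl, hg'⟩ := exists_eq_mul_red_ne_zero hS hg0
    have hinj := injective_of_injective_of_isIntegral γ (Ideal.Quotient.mkₐ _ J) hγ hint
      (Ideal.Quotient.mkₐ_surjective _ J)
    refine hg' (hinj ?_)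
    rw [map_zero]
    exact Ideal.Quotient.eq_zero_iff_mem.2 (Ideal.mem_map_of_mem _ (hsat c g' hc hg))
  let r : S.series n →+* MvPolynomial (Fin n) (ResidueField R) ⧸ J :=
    (Ideal.Quotient.mk J).comp (red hS)
  have hr : Function.Surjective r := Ideal.Quotient.mk_surjective.comp (red_surjective hS)
  choose b hb using fun i => hr (γ (MvPolynomial.X i))
  -- `Θ` sends the indeterminates to lifts of the normalizing elements `γ(X_i)`.
  obtain ⟨Θ, -, hΘ, hΘC, hΘX⟩ := S.exists_series_lift (S.isHom_comp_algebraMap hq)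
    fun i => q (b i)
  have hrI : ∀ g ∈ I, r g = 0 := fun g hg =>
    Ideal.Quotient.eq_zero_iff_mem.2 (Ideal.mem_map_of_mem _ hg)
  let rbar : S.series n ⧸ I →+* MvPolynomial (Fin n) (ResidueField R) ⧸ J :=
    Ideal.Quotient.lift I r hrI
  have hrbar : ∀ g, rbar (q g) = r g := fun g => Ideal.Quotient.lift_mk I r hrI
  have hker : ∀ d, rbar d = 0 → d ∈ 𝔬.map (S.quotientEvaluation hq).struct := by
    intro d hd
    obtain ⟨g, rfl⟩ := hq d
    exact hmem g (Ideal.Quotient.eq_zero_iff_mem.1 ((hrbar g).symm.trans hd))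
  -- `Θ` lifts `γ`: the two composites agree on polynomials and both kill `𝔬 R⟨Y₁, …, Yₛ⟩`.
  have hcomp : ∀ h : S.series s, rbar (Θ h) = γ (red hS h) := by
    intro h
    obtain ⟨p, hp⟩ := S.exists_polynomial_sub_mem_series h
    have h1 : ∀ p : MvPolynomial (Fin s) R, rbar (Θ (MvPolynomial.aeval S.seriesX p)) =
        γ (red hS (MvPolynomial.aeval S.seriesX p)) := by
      intro p
      induction p using MvPolynomial.induction_on with
      | C a =>
        rw [MvPolynomial.aeval_C, hΘC, red_algebraMap, RingHom.comp_apply, hrbar,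
          RingHom.comp_apply, red_algebraMap]
        exact (γ.commutes (residue R a)).symm
      | add p p' hp hp' => simp only [map_add, hp, hp']
      | mul_X p i hp =>
        simp only [map_mul, hp, MvPolynomial.aeval_X, hΘX, red_seriesX, hrbar, hb]
    have h2 : ∀ g ∈ (𝔬.map S.structMap).map (algebraMap R (S.series s)), rbar (Θ g) = 0 := by
      intro g hg
      have : (𝔬.map S.structMap).map (algebraMap R (S.series s)) ≤
          RingHom.ker (rbar.comp Θ) := by
        rw [hS.1, Ideal.map_le_iff_le_comap]
        intro a ha
        rw [Ideal.mem_comap, RingHom.mem_ker, RingHom.comp_apply, hΘC, RingHom.comp_apply, hrbar,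
          RingHom.comp_apply, red_algebraMap, (residue_eq_zero_iff a).2 ha, map_zero, map_zero]
      exact this hg
    have h3 : red hS (h - MvPolynomial.aeval S.seriesX p) = 0 := by
      rw [hS.1, ← ker_red hS] at hp
      exact hp
    rw [← sub_add_cancel h (MvPolynomial.aeval S.seriesX p), map_add, map_add, map_add, map_add,
      h2 _ hp, h1, h3, map_zero]
  have hfin : γ.toRingHom.Finite := by
    have hft : Algebra.FiniteType (ResidueField R)
      (MvPolynomial (Fin n) (ResidueField R) ⧸ J) := inferInstance
    have hc : algebraMap (ResidueField R) (MvPolynomial (Fin n) (ResidueField R) ⧸ J) =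
        γ.toRingHom.comp (algebraMap (ResidueField R) (MvPolynomial (Fin s) (ResidueField R))) := by
      ext a : 1
      exact (γ.commutes a).symm
    exact hint.to_finite ((hc ▸ RingHom.finiteType_algebraMap.mpr hft).of_comp_finiteType)
  obtain ⟨N, e', he'⟩ : ∃ (N : ℕ) (e' : Fin N → MvPolynomial (Fin n) (ResidueField R) ⧸ J),
      ∀ d, ∃ h : Fin N → MvPolynomial (Fin s) (ResidueField R), d = ∑ j, γ (h j) * e' j := by
    let _ := γ.toRingHom.toModule
    have hfin' : Module.Finite (MvPolynomial (Fin s) (ResidueField R))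
      (MvPolynomial (Fin n) (ResidueField R) ⧸ J) := hfin
    obtain ⟨N, e', he'⟩ := Module.Finite.exists_fin (R := MvPolynomial (Fin s) (ResidueField R))
      (M := MvPolynomial (Fin n) (ResidueField R) ⧸ J)
    refine ⟨N, e', fun d => ?_⟩
    have hd : d ∈ Submodule.span (MvPolynomial (Fin s) (ResidueField R)) (Set.range e') :=
      he' ▸ Submodule.mem_top
    obtain ⟨h, hh⟩ := (Submodule.mem_span_range_iff_exists_fun _).1 hd
    exact ⟨h, hh.symm⟩
  choose e he using fun j => hr (e' j)
  refine ⟨Θ, hΘC, ?_, N, fun j => q (e j), ?_⟩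
  -- By saturation a constant can be cancelled in the quotient, so a nonzero kernel element may be
  -- taken with nonzero reduction, against injectivity of `γ`.
  · rw [injective_iff_map_eq_zero]
    intro h hh
    by_contra h0
    obtain ⟨c, h', hc, rfl, hh'⟩ := exists_eq_mul_red_ne_zero hS h0
    refine hh' (hγ ?_)
    rw [map_zero, ← hcomp]
    obtain ⟨g, hg⟩ := hq (Θ h')
    rw [map_mul, hΘC, RingHom.comp_apply, ← hg, ← map_mul, Ideal.Quotient.eq_zero_iff_mem] at hh
    rw [← hg, Ideal.Quotient.eq_zero_iff_mem.2 (hsat c g hc hh), map_zero]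
  · refine Evaluation.span_of_span_mod hΘ
      (S.isSurj_quotientEvaluation hq Θ (algebraMap R _) hΘC) _ fun d => ?_
    obtain ⟨h, hh⟩ := he' (rbar d)
    choose h' hh' using fun j => red_surjective hS (h j)
    refine ⟨h', hker _ ?_⟩
    rw [map_sub, hh, map_sum, sub_eq_zero]
    refine Finset.sum_congr rfl fun j _ => ?_
    rw [map_mul, hcomp, hh', hrbar, he]

end Finiteness

end AnalyticStructure

/-! ### Commutative algebra of finite extensions. -/

lemma nonempty_algHom_quotient_isMaximal {K B Ka : Type*} [Field K] [CommRing B] [Algebra K B]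
    (M : Ideal B) [M.IsMaximal] [Algebra.IsIntegral K (B ⧸ M)] [Field Ka] [IsAlgClosed Ka]
    [Algebra K Ka] : Nonempty (B ⧸ M →ₐ[K] Ka) := by
  let _ := Ideal.Quotient.field M
  exact ⟨IsAlgClosed.lift⟩

lemma finite_of_forall_eq_sum {B Q : Type*} [CommRing B] [CommRing Q] {φ : B →+* Q} {N : ℕ}
    (e : Fin N → Q) (he : ∀ d, ∃ h : Fin N → B, d = ∑ j, φ (h j) * e j) : φ.Finite := by
  let _ := φ.toAlgebra
  refine ⟨Submodule.fg_iff_exists_fin_generating_family.2 ⟨N, e,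
    eq_top_iff.2 fun d _ => (Submodule.mem_span_range_iff_exists_fun _).2 ?_⟩⟩
  obtain ⟨h, hh⟩ := he d
  exact ⟨h, hh.symm⟩

lemma isNoetherianRing_of_finite {B Q : Type*} [CommRing B] [IsNoetherianRing B] [CommRing Q]
    {φ : B →+* Q} (h : φ.Finite) : IsNoetherianRing Q := by
  let _ := φ.toAlgebra
  have : Module.Finite B Q := h
  exact IsNoetherianRing.of_finite B Q

lemma isField_of_finite_injective {B Q : Type*} [CommRing B] [CommRing Q] [IsDomain Q]
    {φ : B →+* Q} (h : φ.Finite) (hφ : Function.Injective φ) (hQ : IsField Q) : IsField B := by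
  let _ := φ.toAlgebra
  have : Module.Finite B Q := h
  have : IsDomain B := hφ.isDomain φ
  exact isField_of_isIntegral_of_isField hφ hQ

lemma fg_of_isNoetherianRing_quotient {B : Type*} [CommRing B] {I : Ideal B} {f : B} (hf : f ∈ I)
    (h : IsNoetherianRing (B ⧸ Ideal.span {f})) : I.FG := by
  refine Ideal.fg_of_fg_map_of_fg_inf_ker_of_surjective (f := Ideal.Quotient.mk (Ideal.span {f}))
    ((isNoetherianRing_iff_ideal_fg _).1 h _) ?_ Ideal.Quotient.mk_surjective
  rw [Ideal.mk_ker, inf_eq_right.2 ((Ideal.span_singleton_le_iff_mem I).2 hf)]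
  exact ⟨{f}, by simp⟩

/-! ### Values of series at points. -/

namespace AnalyticStructure

section Values

variable {A : Type*} [CommRing A] [IsNoetherianRing A] {𝔬 : Ideal A} [IsAdicComplete 𝔬 A]
  {R : Type*} [CommRing R] {S : AnalyticStructure 𝔬 R}

lemma Extends.isHom {R' : Type*} [CommRing R'] [Algebra R R'] {S' : AnalyticStructure 𝔬 R'}
    (h : S'.Extends S) : S.evaluation.IsHom S'.evaluation (algebraMap R R') :=
  fun b f => (h _ f b).symm

lemma Extends.map_specialize {R' : Type*} [CommRing R'] [Algebra R R']
    {S' : AnalyticStructure 𝔬 R'} (h : S'.Extends S) {m n : ℕ} (f : restricted 𝔬 (m + n))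
    (x : Fin m → R) : MvPowerSeries.map (algebraMap R R') (S.specialize f x) =
      S'.specialize f fun i => algebraMap R R' (x i) := by
  ext ν
  rw [coeff_map, coeff_specialize, coeff_specialize, h]

/-- Morphisms on `R⟨Y⟩` which agree on the polynomials are equal if the indeterminates are integral
over `R` modulo the intersection of their kernels. -/
theorem ringHom_ext_of_isIntegral {B : Type*} [CommRing B] {ψ ψ' : S.series n →+* B}
    (hC : ∀ a, ψ (algebraMap R _ a) = ψ' (algebraMap R _ a))
    (hX : ∀ l, ψ (S.seriesX l) = ψ' (S.seriesX l))
    (hint : ∀ l, ∃ W : Polynomial R, W.Monic ∧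
      ψ (W.eval₂ (algebraMap R (S.series n)) (S.seriesX l)) = 0) : ψ = ψ' := by
  -- Neither morphism is assumed compatible with evaluation, so the universal property does not
  -- apply. Modulo `P` the indeterminates are integral over `R`, and every series is congruent to a
  -- polynomial.
  let P := RingHom.ker ψ ⊓ RingHom.ker ψ'
  have hW' : ∀ (W : Polynomial R) l, ψ' (W.eval₂ (algebraMap R (S.series n)) (S.seriesX l)) =
      ψ (W.eval₂ (algebraMap R (S.series n)) (S.seriesX l)) := by
    intro W l
    rw [Polynomial.hom_eval₂, Polynomial.hom_eval₂, hX]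
    congr 1
    ext a : 1
    exact (hC a).symm
  ext g
  obtain ⟨p, hp⟩ := S.exists_aeval_of_isIntegral (q := Ideal.Quotient.mk P)
    Ideal.Quotient.mk_surjective (fun l => by
      obtain ⟨W, hW, h⟩ := hint l
      refine ⟨W, hW, ?_⟩
      rw [← Polynomial.hom_eval₂, Ideal.Quotient.eq_zero_iff_mem]
      exact ⟨h, (hW' W l).trans h⟩) (Ideal.Quotient.mk P g)
  obtain ⟨h1, h2⟩ : MvPolynomial.aeval S.seriesX p - g ∈ P := Ideal.Quotient.eq.1 hp
  have h3 : (ψ.comp (MvPolynomial.aeval S.seriesX : _ →ₐ[R] _).toRingHom) =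
      ψ'.comp (MvPolynomial.aeval S.seriesX : _ →ₐ[R] _).toRingHom := by
    refine MvPolynomial.ringHom_ext (fun a => ?_) fun l => ?_
    · simpa using hC a
    · simpa using hX l
  have h4 : ψ (MvPolynomial.aeval S.seriesX p) = ψ' (MvPolynomial.aeval S.seriesX p) :=
    congrArg (fun γ => γ p) h3
  replace h1 : ψ (_ - g) = 0 := h1
  replace h2 : ψ' (_ - g) = 0 := h2
  rw [map_sub, sub_eq_zero] at h1 h2
  rw [← h1, ← h2, h4]

variable [IsDomain R] {K : Type*} [Field K] [Algebra R K] [IsFractionRing R K]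

/-- Independence of the representation: by the universal property evaluation at `y` is a ring
morphism on `R⟨Y⟩`, and it can be applied to the equality of two representations once denominators
are cleared. -/
lemma hasValueAt_iff {m n : ℕ} {c : R} (hc : c ≠ 0) (f : restricted 𝔬 (m + n)) (x : Fin m → R)
    (y : Fin n → R) (z : K) :
    S.HasValueAt ((algebraMap R K c)⁻¹ • MvPowerSeries.map (algebraMap R K) (S.specialize f x)) y z
      ↔ z = (algebraMap R K c)⁻¹ * algebraMap R K (S.iota (m + n) f (Fin.append x y)) := by
  refine ⟨?_, fun h => ⟨c, hc, m, f, x, rfl, h⟩⟩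
  rintro ⟨c', hc', m', f', x', h, rfl⟩
  have hK : algebraMap R K c ≠ 0 := by simpa using hc
  have hK' : algebraMap R K c' ≠ 0 := by simpa using hc'
  obtain ⟨E, hE, -, hEC, -⟩ := S.exists_series_lift (T := S.evaluation) (θ := RingHom.id R)
    (fun _ _ => rfl) y
  have h1 : algebraMap R (S.series n) c' * S.spec x f = algebraMap R _ c * S.spec x' f' := by
    apply S.toFrac_injective (K := K)
    rw [map_mul, map_mul, toFrac_algebraMap, toFrac_algebraMap, ← Algebra.smul_def,
      ← Algebra.smul_def]
    apply Subtype.ext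
    have h2 := congrArg (fun g => (algebraMap R K c * algebraMap R K c') • g) h
    simp only [smul_smul] at h2
    rw [mul_right_comm, mul_inv_cancel₀ hK, one_mul, mul_assoc, mul_inv_cancel₀ hK', mul_one] at h2
    exact h2
  have h3 := congrArg (algebraMap R K) (congrArg E h1)
  simp only [map_mul, hEC, hE] at h3
  rw [inv_mul_eq_div, inv_mul_eq_div, div_eq_div_iff hK' hK, mul_comm, mul_comm _ (algebraMap R K c')]
  exact h3.symm

end Values

/-! ### Passage from `R⟨Y⟩` to `K⟨Y⟩`. -/

section Ideals

variable {A : Type*} [CommRing A] [IsNoetherianRing A] {𝔬 : Ideal A} [IsAdicComplete 𝔬 A]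
  {R : Type*} [CommRing R] [IsDomain R] (S : AnalyticStructure 𝔬 R)
  {K : Type*} [Field K] [Algebra R K] [IsFractionRing R K] {n : ℕ}

/-- Nonzero constants are units in `K⟨Y⟩`, so contracted ideals satisfy the saturation hypothesis of
`exists_finite_injective`. -/
lemma mem_comap_toFrac_of_mul_mem {I : Ideal (S.fracSeries K n)} {c : R} {g : S.series n}
    (hc : c ≠ 0) (h : algebraMap R _ c * g ∈ I.comap (S.toFrac K n)) :
    g ∈ I.comap (S.toFrac K n) := by
  rw [Ideal.mem_comap, map_mul, toFrac_algebraMap] at h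
  have hK : algebraMap R K c ≠ 0 := by simpa using hc
  exact (Ideal.unit_mul_mem_iff_mem I ((IsUnit.mk0 _ hK).map _)).1 h

/-- A finite injective morphism `R⟨Y₁, …, Yₛ⟩ → R⟨Y⟩ / (I ∩ R⟨Y⟩)` extends to one
`K⟨Y₁, …, Yₛ⟩ → K⟨Y⟩ / I`. -/
theorem exists_fracSeries_finite_injective (I : Ideal (S.fracSeries K n)) {s : ℕ}
    (Θ : S.series s →+* S.series n ⧸ I.comap (S.toFrac K n))
    (hΘ : ∀ a, Θ (algebraMap R _ a) = Ideal.Quotient.mk _ (algebraMap R _ a))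
    (hinj : Function.Injective Θ) {N : ℕ} (e : Fin N → S.series n ⧸ I.comap (S.toFrac K n))
    (he : ∀ d, ∃ h : Fin N → S.series s, d = ∑ j, Θ (h j) * e j) :
    ∃ φ : S.fracSeries K s →ₐ[K] S.fracSeries K n ⧸ I,
      Function.Injective φ ∧
        RingHom.Finite (A := S.fracSeries K s) (B := S.fracSeries K n ⧸ I) φ.toRingHom := by
  let ρ : S.series n ⧸ I.comap (S.toFrac K n) →+* S.fracSeries K n ⧸ I :=
    Ideal.quotientMap I (S.toFrac K n) le_rfl
  have hρ : ∀ g, ρ (Ideal.Quotient.mk _ g) = Ideal.Quotient.mk I (S.toFrac K n g) :=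
    fun g => Ideal.quotientMap_mk
  obtain ⟨φ, hφ⟩ := S.exists_fracSeries_lift (K := K) (n := s) (Q := S.fracSeries K n ⧸ I)
    (RingHom.comp ρ Θ) fun a => by
      rw [RingHom.comp_apply, hΘ, hρ, toFrac_algebraMap]
      rfl
  refine ⟨φ, ?_, ?_⟩
  · rw [injective_iff_map_eq_zero]
    intro f hf
    obtain ⟨c, g, hc, rfl⟩ := S.exists_eq_smul_toFrac f
    have hK : algebraMap R K c ≠ 0 := by simpa using hc
    replace hf := congrArg (algebraMap R K c • ·) hf
    rw [map_smul, hφ, smul_smul, mul_inv_cancel₀ hK, one_smul, smul_zero] at hf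
    have hg : g = 0 := hinj (Ideal.quotientMap_injective (hf.trans
      ((congrArg ρ (map_zero Θ)).trans (map_zero ρ)).symm))
    rw [hg, map_zero, smul_zero]
  · refine finite_of_forall_eq_sum (fun j => ρ (e j)) fun d => ?_
    obtain ⟨f, rfl⟩ := Ideal.Quotient.mk_surjective d
    obtain ⟨c, g, hc, rfl⟩ := S.exists_eq_smul_toFrac f
    obtain ⟨h, hh⟩ := he (Ideal.Quotient.mk _ g)
    refine ⟨fun j => (algebraMap R K c)⁻¹ • S.toFrac K s (h j), ?_⟩
    have h1 : Ideal.Quotient.mk I ((algebraMap R K c)⁻¹ • S.toFrac K n g) =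
        (algebraMap R K c)⁻¹ • Ideal.Quotient.mk I (S.toFrac K n g) :=
      map_smul (Ideal.Quotient.mkₐ K I) _ _
    rw [h1, ← hρ, hh, map_sum, Finset.smul_sum]
    refine Finset.sum_congr rfl fun j _ => ?_
    change _ = φ _ * ρ (e j)
    rw [map_smul, hφ, map_mul, smul_mul_assoc]
    rfl

lemma algebraMap_series_zero_surjective : Function.Surjective (algebraMap R (S.series 0)) := by
  intro g
  refine ⟨coeff 0 g.1, Subtype.ext ?_⟩
  rw [coe_algebraMap_series]
  ext ν
  rw [Subsingleton.elim ν 0, coeff_zero_C]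

lemma algebraMap_fracSeries_zero_surjective :
    Function.Surjective (algebraMap K (S.fracSeries K 0)) := by
  intro g
  refine ⟨coeff 0 g.1, Subtype.ext ?_⟩
  ext ν
  rw [Subsingleton.elim ν 0]
  exact coeff_zero_C _

/-- An indeterminate is nonzero but has constant term zero, so it is not a unit. -/
lemma eq_zero_of_isField_fracSeries (h : IsField (S.fracSeries K n)) : n = 0 := by
  by_contra hn
  let l : Fin n := ⟨0, Nat.pos_of_ne_zero hn⟩
  have hX : (S.toFrac K n (S.seriesX l) : MvPowerSeries (Fin n) K) = X l := by
    rw [coe_toFrac, coe_seriesX, map_X]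
  obtain ⟨b, hb⟩ := h.mul_inv_cancel (a := S.toFrac K n (S.seriesX l)) (by
    intro h0
    have h1 := congrArg (fun g : S.fracSeries K n => coeff (Finsupp.single l 1) g.1) h0
    simp [hX] at h1)
  have h1 := congrArg (fun g : S.fracSeries K n => constantCoeff g.1) hb
  simp [hX] at h1

end Ideals

/-! ### Noether normalization, noetherianity and Nullstellensatz over `K`. -/

section Main

variable {A : Type*} [CommRing A] [IsNoetherianRing A] {𝔬 : Ideal A} [IsAdicComplete 𝔬 A]
  {R : Type*} [CommRing R] [IsDomain R] [ValuationRing R] {S : AnalyticStructure 𝔬 R}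
  (hS : S.IsViable) {K : Type*} [Field K] [Algebra R K] [IsFractionRing R K] {n : ℕ}

include hS

lemma exists_finite_injective_comap (I : Ideal (S.fracSeries K n)) (hI : I ≠ ⊤) :
    ∃ s ≤ n, (I ≠ ⊥ → s < n) ∧ ∃ Θ : S.series s →+* S.series n ⧸ I.comap (S.toFrac K n),
      (∀ a, Θ (algebraMap R _ a) = Ideal.Quotient.mk _ (algebraMap R _ a)) ∧
      Function.Injective Θ ∧ ∃ (N : ℕ) (e : Fin N → S.series n ⧸ I.comap (S.toFrac K n)),
        ∀ d, ∃ h : Fin N → S.series s, d = ∑ j, Θ (h j) * e j := by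
  obtain ⟨s, hs, hlt, h⟩ := exists_finite_injective hS (I.comap (S.toFrac K n))
    (Ideal.comap_ne_top _ hI) fun c g hc hg => S.mem_comap_toFrac_of_mul_mem hc hg
  refine ⟨s, hs, fun hne => hlt ?_, h⟩
  obtain ⟨f, hf, hf0⟩ := Submodule.exists_mem_ne_zero_of_ne_bot hne
  obtain ⟨c, g, hc, rfl⟩ := S.exists_eq_smul_toFrac f
  have hK : algebraMap R K c ≠ 0 := by simpa using hc
  refine (Submodule.ne_bot_iff _).2 ⟨g, ?_, fun h0 => hf0 (by rw [h0, map_zero, smul_zero])⟩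
  have h1 := Submodule.smul_of_tower_mem I (algebraMap R K c) hf
  rwa [smul_smul, mul_inv_cancel₀ hK, one_smul] at h1

/-- Noether normalization over `K`. -/
theorem exists_noether_normalization (I : Ideal (S.fracSeries K n)) (hI : I ≠ ⊤) :
    ∃ s ≤ n, (I ≠ ⊥ → s < n) ∧ ∃ φ : S.fracSeries K s →ₐ[K] S.fracSeries K n ⧸ I,
      Function.Injective φ ∧
        RingHom.Finite (A := S.fracSeries K s) (B := S.fracSeries K n ⧸ I) φ.toRingHom := by
  obtain ⟨s, hs, hlt, Θ, hΘ, hinj, N, e, he⟩ := exists_finite_injective_comap hS I hI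
  exact ⟨s, hs, hlt, S.exists_fracSeries_finite_injective I Θ hΘ hinj e he⟩

theorem isNoetherianRing_fracSeries (n : ℕ) : IsNoetherianRing (S.fracSeries K n) := by
  induction n using Nat.strong_induction_on with
  | _ n ih =>
    refine (isNoetherianRing_iff_ideal_fg _).2 fun I => ?_
    by_cases hI : I = ⊥
    · exact hI ▸ Submodule.fg_bot
    obtain ⟨f, hf, hf0⟩ := Submodule.exists_mem_ne_zero_of_ne_bot hI
    have hJI : Ideal.span {f} ≤ I := (Ideal.span_singleton_le_iff_mem I).2 hf
    by_cases hJ : Ideal.span {f} = ⊤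
    · rw [eq_top_iff.2 (hJ.symm.le.trans hJI)]
      exact Ideal.fg_top _
    -- The quotient by `f` is finite over a ring in fewer variables, noetherian by induction; so `I`
    -- is finitely generated modulo `f`, hence finitely generated.
    obtain ⟨s, -, hlt, φ, -, hφ⟩ := exists_noether_normalization hS (Ideal.span {f}) hJ
    have hs := ih s (hlt (by simpa using hf0))
    exact fg_of_isNoetherianRing_quotient hf (isNoetherianRing_of_finite hφ)

/-- The residue fields of `K⟨Y⟩` are finite over `K`, and the images of the indeterminates in them
are integral over `R`. -/
theorem isIntegral_quotient_isMaximal (M : Ideal (S.fracSeries K n)) [hM : M.IsMaximal] :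
    Algebra.IsIntegral K (S.fracSeries K n ⧸ M) ∧
    ∀ g : S.series n, ∃ W : Polynomial R, W.Monic ∧
      W.eval₂ (algebraMap R (S.series n)) g ∈ M.comap (S.toFrac K n) := by
  obtain ⟨s, -, -, Θ, hΘ, hinj, N, e, he⟩ := exists_finite_injective_comap hS M hM.ne_top
  obtain ⟨φ, hφ, hfin⟩ := S.exists_fracSeries_finite_injective M Θ hΘ hinj e he
  -- The field `K⟨Y⟩/M` is finite over `K⟨Y₁, …, Yₛ⟩`, which is therefore a field.
  obtain rfl : s = 0 := by
    apply S.eq_zero_of_isField_fracSeries (K := K)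
    exact isField_of_finite_injective hfin hφ ((Ideal.Quotient.maximal_ideal_iff_isField_quotient M).1 hM)
  constructor
  · have h := hfin.comp (RingHom.Finite.of_surjective _ (S.algebraMap_fracSeries_zero_surjective
      (K := K)))
    have hc : φ.toRingHom.comp (algebraMap K (S.fracSeries K 0)) =
        algebraMap K (S.fracSeries K n ⧸ M) := φ.comp_algebraMap
    rw [hc] at h
    exact ⟨h.to_isIntegral⟩
  · intro g
    let ι := (Ideal.Quotient.mk (M.comap (S.toFrac K n))).comp (algebraMap R (S.series n))
    -- Finiteness holds already over `R⟨⟩ = R`, which gives integrality over `R` and not merely over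
    -- `K`.
    have hι : ι.Finite := by
      refine finite_of_forall_eq_sum e fun d => ?_
      obtain ⟨h, hh⟩ := he d
      choose r hr using fun j => S.algebraMap_series_zero_surjective (h j)
      refine ⟨r, ?_⟩
      rw [hh]
      refine Finset.sum_congr rfl fun j _ => ?_
      rw [← hr, hΘ]
      rfl
    obtain ⟨W, hW, h0⟩ := hι.to_isIntegral (Ideal.Quotient.mk _ g)
    refine ⟨W, hW, Ideal.Quotient.eq_zero_iff_mem.1 ?_⟩
    rwa [Polynomial.hom_eval₂]

/-- The Nullstellensatz: a proper ideal of `K⟨Y⟩` has a zero. -/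
theorem exists_common_zero (I : Ideal (S.fracSeries K n)) (hI : I ≠ ⊤)
    {Ra Ka : Type*} [CommRing Ra] [IsDomain Ra] [ValuationRing Ra]
    [Field Ka] [IsAlgClosed Ka] [Algebra Ra Ka] [IsFractionRing Ra Ka]
    [Algebra K Ka] [Algebra R Ra] [Algebra R Ka] [IsScalarTower R K Ka]
    [IsScalarTower R Ra Ka] {Sa : AnalyticStructure 𝔬 Ra} (hSa : Sa.Extends S) :
    ∃ y : Fin n → Ra, ∀ f ∈ I, ∀ z : Ka,
      Sa.HasValueAt (MvPowerSeries.map (algebraMap K Ka) (f : MvPowerSeries (Fin n) K)) y z ↔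
        z = 0 := by
  obtain ⟨M, hM, hIM⟩ := Ideal.exists_le_maximal I hI
  obtain ⟨hint, hintX⟩ := isIntegral_quotient_isMaximal hS M
  obtain ⟨ι⟩ := nonempty_algHom_quotient_isMaximal (K := K) (Ka := Ka) M
  let ψ : S.series n →+* Ka := (ι.toRingHom.comp (Ideal.Quotient.mk M)).comp (S.toFrac K n)
  have hψM : ∀ g ∈ M.comap (S.toFrac K n), ψ g = 0 := fun g hg =>
    (congrArg ι (Ideal.Quotient.eq_zero_iff_mem.2 hg)).trans (map_zero ι)
  have hψC : ∀ a, ψ (algebraMap R _ a) = algebraMap R Ka a := by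
    intro a
    have h : ι (algebraMap K _ (algebraMap R K a)) = algebraMap R Ka a := by
      rw [ι.commutes, ← IsScalarTower.algebraMap_apply]
    rw [← h]
    change ι (Ideal.Quotient.mk M (S.toFrac K n (algebraMap R _ a))) = _
    rw [toFrac_algebraMap]
    rfl
  -- The images of the indeterminates are integral over `R`, and the valuation ring `Ra` is
  -- integrally closed in `Ka`.
  have hy : ∀ l, ∃ y : Ra, algebraMap Ra Ka y = ψ (S.seriesX l) := by
    intro l
    obtain ⟨W, hW, h⟩ := hintX (S.seriesX l)
    refine IsIntegrallyClosed.isIntegral_iff.1 (IsIntegral.tower_top (R := R) ⟨W, hW, ?_⟩)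
    rw [← hψM _ h, Polynomial.hom_eval₂]
    congr 1
    ext a : 1
    exact (hψC a).symm
  choose y hy using hy
  obtain ⟨E, hE, -, hEC, hEX⟩ := S.exists_series_lift hSa.isHom y
  -- The abstract morphism `ψ`, which kills `M ∩ R⟨Y⟩`, is identified with evaluation at `y`; so
  -- elements of `M ∩ R⟨Y⟩` vanish at `y`.
  have hEψ : ψ = (algebraMap Ra Ka).comp E := by
    refine ringHom_ext_of_isIntegral (fun a => ?_) (fun l => ?_) fun l => ?_
    · rw [hψC, RingHom.comp_apply, hEC, ← IsScalarTower.algebraMap_apply]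
    · exact (hy l).symm.trans (congrArg (algebraMap Ra Ka) (hEX l).symm)
    · obtain ⟨W, hW, h⟩ := hintX (S.seriesX l)
      exact ⟨W, hW, hψM _ h⟩
  have hinj : Function.Injective (algebraMap R Ra) := by
    refine Function.Injective.of_comp (f := algebraMap Ra Ka) ?_
    rw [← RingHom.coe_comp, ← IsScalarTower.algebraMap_eq, IsScalarTower.algebraMap_eq R K Ka]
    exact (algebraMap K Ka).injective.comp (IsFractionRing.injective R K)
  refine ⟨y, fun f hf z => ?_⟩
  obtain ⟨c, ⟨g, m, h, x, rfl⟩, hc, rfl⟩ := S.exists_eq_smul_toFrac f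
  have hK : algebraMap R K c ≠ 0 := by simpa using hc
  have hcRa : algebraMap R Ra c ≠ 0 := by rwa [Ne, map_eq_zero_iff _ hinj]
  have hval : algebraMap Ra Ka
      (Sa.iota (m + n) h (Fin.append (fun i => algebraMap R Ra (x i)) y)) = 0 := by
    have h1 : S.toFrac K n (S.spec x h) ∈ M := by
      have h1 := Submodule.smul_of_tower_mem I (algebraMap R K c) hf
      rw [smul_smul, mul_inv_cancel₀ hK, one_smul] at h1
      exact hIM h1
    have h2 := hψM _ h1
    rw [hEψ, RingHom.comp_apply, hE] at h2
    exact h2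
  have hcomm : ∀ a, algebraMap K Ka (algebraMap R K a) = algebraMap Ra Ka (algebraMap R Ra a) :=
    fun a => by rw [← IsScalarTower.algebraMap_apply, ← IsScalarTower.algebraMap_apply]
  have hmap : MvPowerSeries.map (algebraMap K Ka)
      (((algebraMap R K c)⁻¹ • S.toFrac K n (S.spec x h) : S.fracSeries K n) :
        MvPowerSeries (Fin n) K) =
      (algebraMap Ra Ka (algebraMap R Ra c))⁻¹ • MvPowerSeries.map (algebraMap Ra Ka)
        (Sa.specialize h fun i => algebraMap R Ra (x i)) := by
    rw [← hSa.map_specialize, ← hcomm, ← map_inv₀ (algebraMap K Ka)]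
    ext ν
    change algebraMap K Ka ((algebraMap R K c)⁻¹ * algebraMap R K _) =
      algebraMap K Ka _ * algebraMap Ra Ka (algebraMap R Ra _)
    rw [map_mul, hcomm]
    rfl
  refine (iff_of_eq (congrArg (fun F => Sa.HasValueAt F y z) hmap)).trans ?_
  rw [hasValueAt_iff hcRa, hval, mul_zero]

end Main

end AnalyticStructure

end AnalyticRing

theorem mainTheorem12 {A : Type*} [CommRing A] [IsNoetherianRing A]
    (𝔬 : Ideal A) (h𝔬 : 𝔬 ≠ ⊤) [IsAdicComplete 𝔬 A]
    {R : Type*} [CommRing R] [IsDomain R] [ValuationRing R]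
    (S : AnalyticRing.AnalyticStructure 𝔬 R) (hS : S.IsViable)
    {K : Type*} [Field K] [Algebra R K] [IsFractionRing R K] (n : ℕ) :
    IsDomain (S.fracSeries K n) ∧
    IsNoetherianRing (S.fracSeries K n) ∧
    ∀ I : Ideal (S.fracSeries K n), I ≠ ⊤ →
      (∃ m : ℕ, m ≤ n ∧ ∃ φ : S.fracSeries K m →ₐ[K] (S.fracSeries K n ⧸ I),
        Function.Injective φ ∧ RingHom.Finite (A := S.fracSeries K m) (B := S.fracSeries K n ⧸ I) φ.toRingHom) ∧
      -- common zeros, in any algebraically closed valued field extension `Ka` of `K` whose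
      -- valuation ring `Ra` carries an analytic structure extending that of `R`
      ∀ (Ra : Type*) (Ka : Type*) [CommRing Ra] [IsDomain Ra] [ValuationRing Ra]
        [Field Ka] [IsAlgClosed Ka] [Algebra Ra Ka] [IsFractionRing Ra Ka]
        [Algebra K Ka] [Algebra R Ra] [Algebra R Ka] [IsScalarTower R K Ka]
        [IsScalarTower R Ra Ka] [IsLocalHom (algebraMap R Ra)]
        (Sa : AnalyticRing.AnalyticStructure 𝔬 Ra), Sa.Extends S →
        ∃ y : Fin n → Ra, ∀ f ∈ I, ∀ z : Ka,
          Sa.HasValueAt (MvPowerSeries.map (algebraMap K Ka) (f : MvPowerSeries (Fin n) K)) y z ↔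
            z = 0 := by
  refine ⟨NoZeroDivisors.to_isDomain _, AnalyticRing.AnalyticStructure.isNoetherianRing_fracSeries hS n,
    fun I hI => ⟨?_, ?_⟩⟩
  · obtain ⟨s, hs, -, h⟩ :=
      AnalyticRing.AnalyticStructure.exists_noether_normalization hS I hI
    exact ⟨s, hs, h⟩
  · intro Ra Ka _ _ _ _ _ _ _ _ _ _ _ _ _ Sa hSa
    exact AnalyticRing.AnalyticStructure.exists_common_zero hS I hI hSa
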